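/- Let $G$ be an infinite, connected, locally finite graph without loops (multiple edges are allowed), regarded as an electric network in which every edge has resistance $1$ ohm. Definitions. For a finite set $S$ of vertices, let $\mathrm{cut}(S)$ be the subgraph induced on $S$, and let $\mathrm{short}(S)$ be the finite graph obtained by identifying all vertices outside $S$ to a single new vertex $\infty$ and discarding the loops at $\infty$. A sequence $(T_n)$ of finite sets of vertices is *swelling* if every finite set of vertices is contained in $T_n$ for all large $n$; it is *pinching* if moreover $|\partial_E T_n|/|T_n|\to 0$, where $\partial_E T$ is the set of edges joining a vertex in $T$ to a vertex outside $T$. $G$ is *smallish* if it has a pinching sequence. Two vertices (or two edges) are of the same *kind* if an automorphism of $G$ maps one to the other; $G$ is *symmetrical* if it has only finitely many kinds of vertices, or only finitely many kinds of edges. For distinct vertices $p,q$, the *even flow* (respectively the *odd flow*) from $p$ to $q$ is the limit in the energy norm, along every swelling sequence $(T_n)$, of the unit current flow from $p$ to $q$ in $\mathrm{cut}(T_n)$ (respectively in $\mathrm{short}(T_n)$) determined by Kirchhoff's laws. The *even* (respectively *odd*) *resistance* between $p$ and $q$ is the energy dissipation $\sum_e \theta(e)^2$ of the even (respectively odd)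 flow $\theta$ from $p$ to $q$. The resistance of an edge is the resistance between its two ends. The *relative frequency* of a kind of vertices (respectively edges) is the limit of the proportion of vertices (respectively edges) of this kind in $\mathrm{cut}(T_n)$, and also in $\mathrm{short}(T_n)$, along any pinching sequence $(T_n)$. The *average* of a function that depends only on the kind of a vertex (respectively edge) is the average over the kinds, weighted by these relative frequencies. Theorem. Let $G$ be as above, and suppose that $G$ is smallish and symmetrical. Then the relative frequencies of the kinds of vertices, and those of the kinds of edges, exist (the same limits for $\mathrm{cut}$ and for $\mathrm{short}$ and for all pinching sequences) and are positive rational numbers summing to $1$; the even and odd flows between the ends of every edge exist and have finite energy; the even and the odd resistance of an edge depend only on its kind; and $$\text{average even resistance over the edges}\;=\;\text{average odd resistance over the edges}\;=\;\frac{2}{\text{average valence of the vertices}}.$$ -/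

import Mathlib

open Filter Topology
open scoped Graph ENNReal

noncomputable section

namespace Graph

variable {α β : Type*}

/-! ### Basic notions for multigraphs -/

/-- Every vertex is incident with only finitely many edges. -/
def IsLocallyFinite (G : Graph α β) : Prop :=
  ∀ x ∈ V(G), (G.incidenceSet x).Finite

/-- Any two vertices are joined by a walk. -/
def IsConnected (G : Graph α β) : Prop :=
  V(G).Nonempty ∧ ∀ x ∈ V(G), ∀ y ∈ V(G), Relation.ReflTransGen G.Adj x y

/-- The number of edges incident with `x` (used for loopless graphs only). -/
def valence (G : Graph α β) (x : α) : ℕ := (G.incidenceSet x).ncard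

/-! ### Kinds of vertices and of edges -/

/-- A symmetry of a multigraph: a permutation of the vertices together with a permutation of
the edges that preserve the relation of an edge to its ends. -/
structure Symmetry (G : Graph α β) where
  /-- the action on vertices -/
  onV : V(G) ≃ V(G)
  /-- the action on edges -/
  onE : E(G) ≃ E(G)
  isLink_iff : ∀ (e : E(G)) (x y : V(G)),
    G.IsLink (onE e : β) (onV x : α) (onV y : α) ↔ G.IsLink (e : β) (x : α) (y : α)

/-- The identity symmetry. -/
def Symmetry.refl (G : Graph α β) : G.Symmetry := ⟨Equiv.refl _, Equiv.refl _, fun _ _ _ => Iff.rfl⟩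

/-- The inverse of a symmetry. -/
def Symmetry.symm {G : Graph α β} (s : G.Symmetry) : G.Symmetry :=
  ⟨s.onV.symm, s.onE.symm, fun e x y => by
    simpa using (s.isLink_iff (s.onE.symm e) (s.onV.symm x) (s.onV.symm y)).symm⟩

/-- The composition of two symmetries. -/
def Symmetry.trans {G : Graph α β} (s t : G.Symmetry) : G.Symmetry :=
  ⟨s.onV.trans t.onV, s.onE.trans t.onE, fun e x y =>
    (t.isLink_iff (s.onE e) (s.onV x) (s.onV y)).trans (s.isLink_iff e x y)⟩

/-- Two vertices are of the same kind if a symmetry maps one to the other. -/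
def vertexSetoid (G : Graph α β) : Setoid V(G) where
  r v w := ∃ s : G.Symmetry, s.onV v = w
  iseqv :=
    { refl := fun _ => ⟨Symmetry.refl G, rfl⟩
      symm := by
        rintro v w ⟨s, rfl⟩
        exact ⟨s.symm, s.onV.symm_apply_apply v⟩
      trans := by
        rintro u v w ⟨s, rfl⟩ ⟨t, rfl⟩
        exact ⟨s.trans t, rfl⟩ }

/-- Two edges are of the same kind if a symmetry maps one to the other. -/
def edgeSetoid (G : Graph α β) : Setoid E(G) where
  r e f := ∃ s : G.Symmetry, s.onE e = f
  iseqv :=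
    { refl := fun _ => ⟨Symmetry.refl G, rfl⟩
      symm := by
        rintro v w ⟨s, rfl⟩
        exact ⟨s.symm, s.onE.symm_apply_apply v⟩
      trans := by
        rintro u v w ⟨s, rfl⟩ ⟨t, rfl⟩
        exact ⟨s.trans t, rfl⟩ }

/-- The kinds of vertices of `G`. -/
def VertexKind (G : Graph α β) := Quotient G.vertexSetoid

/-- The kinds of edges of `G`. -/
def EdgeKind (G : Graph α β) := Quotient G.edgeSetoid

/-- The kind of a vertex. -/
def vertexKind (G : Graph α β) (v : V(G)) : G.VertexKind := Quotient.mk G.vertexSetoid v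

/-- The kind of an edge. -/
def edgeKind (G : Graph α β) (e : E(G)) : G.EdgeKind := Quotient.mk G.edgeSetoid e

/-- A graph is symmetrical if it has finitely many kinds of vertices, or finitely many kinds of
edges. -/
def IsSymmetrical (G : Graph α β) : Prop := Finite G.VertexKind ∨ Finite G.EdgeKind

/-! ### Finite approximations -/

/-- The cut network of `S`: throw away all vertices outside `S` and all edges incident with
them. -/
def cutNetwork (G : Graph α β) (S : Finset α) : Graph α β := G.induce (S : Set α)

open Classical in
/-- Identify all points outside `S` to the single new point `∞ = none`. -/
def collapse (S : Finset α) (x : α) : Option α := if x ∈ S then some x else none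

/-- The short network of `S`: identify all the vertices outside `S` to a single new vertex
`∞ = none`. Edges with both ends outside `S` would become loops at `∞`, and are removed. -/
def shortNetwork (G : Graph α β) (S : Finset α) : Graph (Option α) β :=
  (G.map (collapse S)).deleteEdges {e | ∃ x, (G.map (collapse S)).IsLoopAt e x}

/-- The edges connecting a vertex in `S` to a vertex outside `S`. -/
def edgeBoundary (G : Graph α β) (S : Finset α) : Set β :=
  {e | ∃ x ∈ S, ∃ y ∉ S, G.IsLink e x y}

/-- A sequence of finite sets of vertices such that any finite set of vertices is eventually
contained in its members. -/
def IsSwelling (G : Graph α β) (T : ℕ → Finset α) : Prop :=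
  (∀ n, (T n : Set α) ⊆ V(G)) ∧ ∀ S : Finset α, (S : Set α) ⊆ V(G) → ∀ᶠ n in atTop, S ⊆ T n

/-- A swelling sequence along which `|edge boundary| / |size|` goes to `0`. -/
def IsPinching (G : Graph α β) (T : ℕ → Finset α) : Prop :=
  G.IsSwelling T ∧
    Tendsto (fun n => ((G.edgeBoundary (T n)).ncard : ℝ) / ((T n).card : ℝ)) atTop (𝓝 0)

/-- A graph is smallish if it has a pinching sequence. -/
def IsSmallish (G : Graph α β) : Prop := ∃ T : ℕ → Finset α, G.IsPinching T

/-! ### Relative frequencies and averages -/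

/-- `f` gives the relative frequencies of the kinds of vertices: positive rational numbers
summing to `1` which are the limits of the actual relative frequencies in the cut graphs and in
the short graphs along any pinching sequence. -/
structure IsVertexFrequency (G : Graph α β) (f : G.VertexKind → ℚ) : Prop where
  pos : ∀ k, 0 < f k
  sum_eq_one : ∑ᶠ k, f k = 1
  tendsto_cut : ∀ T, G.IsPinching T → ∀ k, Tendsto
    (fun n => ({v : V(G) | (v : α) ∈ V(G.cutNetwork (T n)) ∧ G.vertexKind v = k}.ncard : ℝ) /
      (V(G.cutNetwork (T n)).ncard : ℝ)) atTop (𝓝 (f k : ℝ))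
  tendsto_short : ∀ T, G.IsPinching T → ∀ k, Tendsto
    (fun n =>
      ({v : V(G) | some (v : α) ∈ V(G.shortNetwork (T n)) ∧ G.vertexKind v = k}.ncard : ℝ) /
      (V(G.shortNetwork (T n)).ncard : ℝ)) atTop (𝓝 (f k : ℝ))

/-- `g` gives the relative frequencies of the kinds of edges: positive rational numbers
summing to `1` which are the limits of the actual relative frequencies in the cut graphs and in
the short graphs along any pinching sequence. -/
structure IsEdgeFrequency (G : Graph α β) (g : G.EdgeKind → ℚ) : Prop where
  pos : ∀ k, 0 < g k
  sum_eq_one : ∑ᶠ k, g k = 1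
  tendsto_cut : ∀ T, G.IsPinching T → ∀ k, Tendsto
    (fun n => ({e : E(G) | (e : β) ∈ E(G.cutNetwork (T n)) ∧ G.edgeKind e = k}.ncard : ℝ) /
      (E(G.cutNetwork (T n)).ncard : ℝ)) atTop (𝓝 (g k : ℝ))
  tendsto_short : ∀ T, G.IsPinching T → ∀ k, Tendsto
    (fun n => ({e : E(G) | (e : β) ∈ E(G.shortNetwork (T n)) ∧ G.edgeKind e = k}.ncard : ℝ) /
      (E(G.shortNetwork (T n)).ncard : ℝ)) atTop (𝓝 (g k : ℝ))

/-- `φ` depends only on the kind of a vertex, and `a` is its average with respect to the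
relative frequencies of the kinds of vertices. -/
def IsVertexAverage (G : Graph α β) (φ : V(G) → ℝ) (a : ℝ) : Prop :=
  ∃ (f : G.VertexKind → ℚ) (ψ : G.VertexKind → ℝ), G.IsVertexFrequency f ∧
    (∀ v, φ v = ψ (G.vertexKind v)) ∧ a = ∑ᶠ k, (f k : ℝ) * ψ k

/-- `φ` depends only on the kind of an edge, and `a` is its average with respect to the
relative frequencies of the kinds of edges. -/
def IsEdgeAverage (G : Graph α β) (φ : E(G) → ℝ) (a : ℝ) : Prop :=
  ∃ (g : G.EdgeKind → ℚ) (ψ : G.EdgeKind → ℝ), G.IsEdgeFrequency g ∧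
    (∀ e, φ e = ψ (G.edgeKind e)) ∧ a = ∑ᶠ k, (g k : ℝ) * ψ k

/-! ### Flows and resistances, every edge having a resistance of one ohm -/

/-- A flow through the edges of `H`: here `θ e x` is the current that leaves the vertex `x`
along the edge `e`. -/
structure IsFlow (H : Graph α β) (θ : β → α → ℝ) : Prop where
  eq_zero : ∀ e x, ¬ H.Inc e x → θ e x = 0
  antisymm : ∀ e x y, H.IsLink e x y → θ e y = - θ e x

/-- The source strength at `x`: the total current that leaves `x`. -/
def source (θ : β → α → ℝ) (x : α) : ℝ := ∑ᶠ e, θ e x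

/-- The energy dissipation of a flow, that is, the sum over all edges of the square of the
current (each edge appears twice in the sum, once for each of its ends). -/
def energy (θ : β → α → ℝ) : ℝ≥0∞ := (∑' i : β × α, ENNReal.ofReal (θ i.1 i.2 ^ 2)) / 2

open Classical in
/-- `θ` is the unit current flow from `p` to `q` in the (finite) network `H`, as determined by
Kirchhoff's laws: it comes from a potential by Ohm's law, and its source strength is `+1` at
`p`, `-1` at `q` and `0` at every other vertex. -/
structure IsUnitCurrent (H : Graph α β) (p q : α) (θ : β → α → ℝ) : Prop where
  isFlow : H.IsFlow θ
  source_mem : p ∈ V(H)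
  sink_mem : q ∈ V(H)
  potential : ∃ u : α → ℝ, ∀ e x y, H.IsLink e x y → θ e x = u x - u y
  source_eq : ∀ x ∈ V(H),
    source θ x = (if x = p then (1 : ℝ) else 0) - (if x = q then (1 : ℝ) else 0)

open Classical in
/-- A flow in the short network of `S`, seen as an assignment of currents to the edges of
`G`. -/
def ofShort (G : Graph α β) (S : Finset α) (θ : β → Option α → ℝ) : β → α → ℝ :=
  fun e x => if G.Inc e x then θ e (collapse S x) else 0

/-- `θ` is the even flow from `p` to `q`: the limit, in the energy norm, of the unit current
flows from `p` to `q` in the cut networks of `T` as `T` swells to fill up `G`. -/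
def IsEvenFlow (G : Graph α β) (p q : α) (θ : β → α → ℝ) : Prop :=
  ∀ T, G.IsSwelling T → ∃ i : ℕ → β → α → ℝ,
    (∀ᶠ n in atTop, (G.cutNetwork (T n)).IsUnitCurrent p q (i n)) ∧
    Tendsto (fun n => energy (i n - θ)) atTop (𝓝 0)

/-- `θ` is the odd flow from `p` to `q`: the limit, in the energy norm, of the unit current
flows from `p` to `q` in the short networks of `T` as `T` swells to fill up `G`. -/
def IsOddFlow (G : Graph α β) (p q : α) (θ : β → α → ℝ) : Prop :=
  ∀ T, G.IsSwelling T → ∃ i : ℕ → β → Option α → ℝ,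
    (∀ᶠ n in atTop, (G.shortNetwork (T n)).IsUnitCurrent (some p) (some q) (i n)) ∧
    Tendsto (fun n => energy (G.ofShort (T n) (i n) - θ)) atTop (𝓝 0)

/-- The even flow from `p` to `q` exists, and `r` is its (finite) energy dissipation. -/
def IsEvenResistance (G : Graph α β) (p q : α) (r : ℝ) : Prop :=
  ∃ θ, G.IsEvenFlow p q θ ∧ energy θ ≠ ⊤ ∧ r = (energy θ).toReal

/-- The odd flow from `p` to `q` exists, and `r` is its (finite) energy dissipation. -/
def IsOddResistance (G : Graph α β) (p q : α) (r : ℝ) : Prop :=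
  ∃ θ, G.IsOddFlow p q θ ∧ energy θ ≠ ⊤ ∧ r = (energy θ).toReal

end Graph

end

/-! Orient the edges and work in the Hilbert space of square summable functions on them.
Combinations of stars are the gradients of finitely supported potentials, and having no sources
means being orthogonal to every star. Let Z (`evenSpace`) be the closure of the finite cycles and B
(`oddSpace`) the closure of the span of the stars. Then Z and B are orthogonal but need not fill the
space, which is why even and odd flows can differ. For the unit vector `chi e` of an edge e, the
even flow is `chi e` minus its projection to Z, and the odd flow is its projection to B. The
currents in cut(S) and short(S) obey the same formulas with finite-dimensional subspaces increasing
to Z and B, so they converge (`isEvenFlow_evenVec`, `isOddFlow_oddVec`) and compare monotonically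
with their limits.

The engine is Foster's identity: the sum over e of |P_K chi(e)|^2 is the trace of the projection
P_K, hence the dimension of K. The gradients on cut(S) have dimension at most |S|, those on short(S)
exactly |S|. An edge of cut(S) has even resistance at most its resistance in cut(S); an edge of
short(S) has odd resistance at least its resistance there. Odd resistances are at most even ones and
at most 1. Summing over the edges inside S, |S| - |∂S| ≤ Σ odd ≤ Σ even ≤ |S|, so both sums, divided
by |S|, tend to 1 along every pinching sequence (`hasDensity_sum_evenVec`, `hasDensity_sum_oddVec`).

Frequencies come from double counting the incidences between a kind of vertices and a kind of edges
(`sum_incCount_eq`). Up to the boundary this fixes the ratio of the two counts as a positive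
rational, and connectedness links all kinds (`exists_kind_densities`). If Y is the limiting number
of edges per vertex, both average resistances are 1/Y and the average valence is 2Y. Symmetries act
isometrically and preserve Z and B, so resistances depend only on the kind. -/

noncomputable section

namespace Graph

/-! ### An orientation of the edges -/

section Orientation

variable {α β : Type*} {G : Graph α β}

/-- A chosen end of an edge. -/
def tail (e : E(G)) : α := (exists_isLink_of_mem_edgeSet e.2).choose

/-- The end of an edge that is not its `tail`. -/
def head (e : E(G)) : α := (exists_isLink_of_mem_edgeSet e.2).choose_spec.choose

lemma isLink_tail_head (e : E(G)) : G.IsLink e (tail e) (head e) :=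
  (exists_isLink_of_mem_edgeSet e.2).choose_spec.choose_spec

open Classical in
/-- The entries of the signed incidence matrix: `1` at the tail and `-1` at the head. -/
def sgn (e : E(G)) (x : α) : ℝ :=
  (if x = tail e then 1 else 0) - (if x = head e then 1 else 0)

lemma sgn_eq_zero {e : E(G)} {x : α} (h : ¬ G.Inc e x) : sgn e x = 0 := by
  have h1 : x ≠ tail e := fun h' => h (h' ▸ (isLink_tail_head e).inc_left)
  have h2 : x ≠ head e := fun h' => h (h' ▸ (isLink_tail_head e).inc_right)
  simp [sgn, h1, h2]

lemma sgn_right [G.Loopless] {e : E(G)} {x y : α} (h : G.IsLink e x y) : sgn e y = -sgn e x := by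
  have hne := (isLink_tail_head e).ne
  rcases h.eq_and_eq_or_eq_and_eq (isLink_tail_head e) with ⟨rfl, rfl⟩ | ⟨rfl, rfl⟩ <;>
    simp [sgn, hne, hne.symm]

-- Multiplying by `sgn e x` reorients `e` to start at `x`; this removes the arbitrary choice of tail
-- from later computations.
open Classical in
lemma sgn_mul_sgn [G.Loopless] {e : E(G)} {x y : α} (h : G.IsLink e x y) (z : α) :
    sgn e x * sgn e z = (if z = x then 1 else 0) - (if z = y then 1 else 0) := by
  have hne := (isLink_tail_head e).ne
  rcases h.eq_and_eq_or_eq_and_eq (isLink_tail_head e) with ⟨rfl, rfl⟩ | ⟨rfl, rfl⟩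
  · simp [sgn, hne]
  · simp [sgn, hne.symm]

lemma sgn_mul_self [G.Loopless] {e : E(G)} {x : α} (h : G.Inc e x) : sgn e x * sgn e x = 1 := by
  obtain ⟨y, hy⟩ := h
  rw [sgn_mul_sgn hy]
  simp [hy.ne]

lemma sgn_tail [G.Loopless] (e : E(G)) : sgn e (tail e) = 1 := by
  simp [sgn, (isLink_tail_head e).ne]

lemma finite_support_sgn (hfin : G.IsLocallyFinite) (x : α) :
    {e : E(G) | sgn e x ≠ 0}.Finite := by
  by_cases hx : x ∈ V(G)
  · refine Set.Finite.subset ((hfin x hx).preimage Subtype.val_injective.injOn) fun e he => ?_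
    by_contra h
    exact he (sgn_eq_zero h)
  · convert Set.finite_empty
    ext e
    simp only [ne_eq, Set.mem_ofPred_eq, Set.mem_empty_iff_false, iff_false, not_not]
    exact sgn_eq_zero fun h => hx h.vertex_mem

end Orientation

/-! ### The Hilbert space of flows of finite energy -/

section Hilbert

variable {α β : Type*} {G : Graph α β}

/-- The square summable functions on the edges. -/
abbrev EdgeSpace (G : Graph α β) := lp (fun _ : E(G) => ℝ) 2

/-- A function with finite support, as an element of the edge space. -/
def finiteVec (f : E(G) → ℝ) (hf : {e | f e ≠ 0}.Finite) : G.EdgeSpace :=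
  ⟨f, (memℓp_zero hf).of_exponent_ge zero_le⟩

@[simp] lemma finiteVec_apply (f : E(G) → ℝ) (hf : {e | f e ≠ 0}.Finite) (e : E(G)) :
    finiteVec f hf e = f e := rfl

open Classical in
/-- The unit flow through a single edge. -/
def chi (e : E(G)) : G.EdgeSpace := lp.single 2 e 1

open Classical in
lemma chi_apply (e f : E(G)) : chi e f = if f = e then 1 else 0 := by
  simp [chi, lp.single_apply, Pi.single_apply]

lemma inner_chi_right (h : G.EdgeSpace) (e : E(G)) : inner ℝ h (chi e) = h e := by
  classical
  simp [chi, lp.inner_single_right]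

lemma inner_chi_left (h : G.EdgeSpace) (e : E(G)) : inner ℝ (chi e) h = h e := by
  rw [real_inner_comm, inner_chi_right]

lemma norm_chi (e : E(G)) : ‖(chi e : G.EdgeSpace)‖ = 1 := by
  have : ‖(chi e : G.EdgeSpace)‖ ^ 2 = 1 := by
    rw [← real_inner_self_eq_norm_sq, inner_chi_left, chi_apply, if_pos rfl]
  nlinarith [norm_nonneg (chi e : G.EdgeSpace)]

lemma edgeSpace_inner_eq_tsum (h k : G.EdgeSpace) : inner ℝ h k = ∑' e, h e * k e := by
  rw [lp.inner_eq_tsum]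
  simp [mul_comm]

/-- The star of a vertex, restricted to a set of edges. -/
def starIn (hfin : G.IsLocallyFinite) (F : Set E(G)) (x : α) : G.EdgeSpace :=
  finiteVec (F.indicator fun e => sgn e x)
    ((finite_support_sgn hfin x).subset fun _ he h => he (by
      rw [Set.indicator_apply_eq_zero]; exact fun _ => h))

open Classical in
lemma starIn_apply (hfin : G.IsLocallyFinite) (F : Set E(G)) (x : α) (e : E(G)) :
    starIn hfin F x e = if e ∈ F then sgn e x else 0 := by
  simp [starIn, Set.indicator_apply]

/-- The star of a vertex. -/
abbrev starVec (hfin : G.IsLocallyFinite) (x : α) : G.EdgeSpace := starIn hfin Set.univ x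

lemma starVec_apply (hfin : G.IsLocallyFinite) (x : α) (e : E(G)) :
    starVec hfin x e = sgn e x := by
  simp [starIn_apply]

/-- Lets the node law inside a cut network be tested with the full stars of `G`. -/
lemma inner_starIn (hfin : G.IsLocallyFinite) (F : Set E(G)) (x : α) (h : G.EdgeSpace)
    (hF : ∀ e ∉ F, h e = 0) : inner ℝ (starIn hfin F x) h = inner ℝ (starVec hfin x) h := by
  rw [edgeSpace_inner_eq_tsum, edgeSpace_inner_eq_tsum]
  refine tsum_congr fun e => ?_
  rw [starIn_apply, starVec_apply]
  split_ifs with he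
  · rfl
  · simp [hF e he]

/-- The combinations of the stars, restricted to `F`, of the vertices in `S`. -/
def starSpan (hfin : G.IsLocallyFinite) (F : Set E(G)) (S : Finset α) :
    Submodule ℝ G.EdgeSpace :=
  Submodule.span ℝ (starIn hfin F '' S)

instance (hfin : G.IsLocallyFinite) (F : Set E(G)) (S : Finset α) :
    FiniteDimensional ℝ (starSpan hfin F S) :=
  FiniteDimensional.span_of_finite ℝ (S.finite_toSet.image _)

/-- Ohm's law: the coefficients of a combination of stars are a potential. That it vanishes off `S`
is what later puts ∞ at potential 0 in the short network. -/
lemma exists_potential [G.Loopless] {hfin : G.IsLocallyFinite} {F : Set E(G)} {S : Finset α}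
    {h : G.EdgeSpace} (hh : h ∈ starSpan hfin F S) :
    ∃ u : α → ℝ, (∀ x ∉ S, u x = 0) ∧ (∀ e ∉ F, h e = 0) ∧
      ∀ (e : E(G)) (x y : α), e ∈ F → G.IsLink e x y → sgn e x * h e = u x - u y := by
  classical
  induction hh using Submodule.span_induction with
  | mem h hh =>
    obtain ⟨z, hz, rfl⟩ := hh
    refine ⟨Pi.single z 1, fun x hx => ?_, fun e he => ?_, fun e x y he hxy => ?_⟩
    · exact Pi.single_eq_of_ne (by rintro rfl; exact hx hz) _
    · simp [starIn_apply, he]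
    · rw [starIn_apply, if_pos he, sgn_mul_sgn hxy]
      simp [Pi.single_apply, eq_comm]
  | zero => exact ⟨0, by simp, by simp, by simp⟩
  | add h k _ _ ih ik =>
    obtain ⟨u, hu, hF, hh⟩ := ih
    obtain ⟨v, hv, kF, hk⟩ := ik
    refine ⟨u + v, fun x hx => by simp [hu x hx, hv x hx], fun e he => by simp [hF e he, kF e he],
      fun e x y he hxy => ?_⟩
    have h1 := hh e x y he hxy
    have h2 := hk e x y he hxy
    simp only [lp.coeFn_add, Pi.add_apply]
    linear_combination h1 + h2
  | smul c h _ ih =>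
    obtain ⟨u, hu, hF, hh⟩ := ih
    refine ⟨c • u, fun x hx => by simp [hu x hx], fun e he => by simp [hF e he],
      fun e x y he hxy => ?_⟩
    have h1 := hh e x y he hxy
    simp only [lp.coeFn_smul, Pi.smul_apply, smul_eq_mul]
    linear_combination c * h1

/-- The functions supported in `F`. -/
def supported (F : Set E(G)) : Submodule ℝ G.EdgeSpace := Submodule.span ℝ (chi '' F)

lemma mem_supported_iff {F : Set E(G)} (hF : F.Finite) {h : G.EdgeSpace} :
    h ∈ supported F ↔ ∀ e ∉ F, h e = 0 := by
  classical
  constructor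
  · intro hh e he
    induction hh using Submodule.span_induction with
    | mem h hh =>
      obtain ⟨f, hf, rfl⟩ := hh
      rw [chi_apply, if_neg]
      rintro rfl
      exact he hf
    | zero => simp
    | add h k _ _ ih ik => simp [ih, ik]
    | smul c h _ ih => simp [ih]
  · intro hh
    have : h = ∑ e ∈ hF.toFinset, h e • chi e := by
      ext f
      rw [lp.coeFn_sum, Finset.sum_apply]
      simp only [lp.coeFn_smul, Pi.smul_apply, chi_apply, smul_eq_mul, mul_ite, mul_one, mul_zero]
      rw [Finset.sum_ite_eq]
      split_ifs with hf
      · rfl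
      · exact hh f (by simpa using hf)
    rw [this]
    exact Submodule.sum_mem _ fun e he => Submodule.smul_mem _ _
      (Submodule.subset_span ⟨e, by simpa using he, rfl⟩)

/-- The functions without sources that are supported in `F`. -/
def cycleSpace (hfin : G.IsLocallyFinite) (F : Set E(G)) : Submodule ℝ G.EdgeSpace :=
  supported F ⊓ (Submodule.span ℝ (Set.range (starVec hfin)))ᗮ

lemma mem_cycleSpace_iff {hfin : G.IsLocallyFinite} {F : Set E(G)} {h : G.EdgeSpace} :
    h ∈ cycleSpace hfin F ↔ h ∈ supported F ∧ ∀ x, inner ℝ (starVec hfin x) h = 0 := by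
  rw [cycleSpace, Submodule.mem_inf, Submodule.mem_orthogonal]
  refine and_congr_right fun _ => ⟨fun hh x => hh _ (Submodule.subset_span ⟨x, rfl⟩), fun hh u hu => ?_⟩
  induction hu using Submodule.span_induction with
  | mem u hu => obtain ⟨x, rfl⟩ := hu; exact hh x
  | zero => simp
  | add u v _ _ hu hv => rw [inner_add_left, hu, hv, add_zero]
  | smul c u _ hu => rw [inner_smul_left, hu, mul_zero]

end Hilbert

/-! ### Flows -/

section Flow

variable {α β : Type*} {G : Graph α β}

open Classical in
/-- The flow given by a function on the oriented edges. -/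
def toFlow (h : E(G) → ℝ) : β → α → ℝ :=
  fun e x => if he : e ∈ E(G) then sgn ⟨e, he⟩ x * h ⟨e, he⟩ else 0

lemma toFlow_coe (h : E(G) → ℝ) (e : E(G)) (x : α) : toFlow h e x = sgn e x * h e := by
  simp [toFlow]

lemma toFlow_of_notMem (h : E(G) → ℝ) {e : β} (he : e ∉ E(G)) (x : α) : toFlow h e x = 0 := by
  simp [toFlow, he]

lemma toFlow_sub (h k : E(G) → ℝ) : toFlow (h - k) = toFlow h - toFlow k := by
  ext e x
  by_cases he : e ∈ E(G)
  · simp [toFlow, he, mul_sub]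
  · simp [toFlow, he]

/-- Each edge is counted once at each of its two distinct ends, which cancels the division by 2 in
`energy`. -/
lemma energy_toFlow [G.Loopless] (h : G.EdgeSpace) :
    energy (toFlow h) = ENNReal.ofReal (‖h‖ ^ 2) := by
  classical
  have h1 : ∀ e : E(G), ∑' x, ENNReal.ofReal (toFlow h e x ^ 2) = 2 * ENNReal.ofReal (h e ^ 2) := by
    intro e
    have hl := isLink_tail_head e
    rw [tsum_eq_sum (s := {tail e, head e}), Finset.sum_pair hl.ne, toFlow_coe, toFlow_coe,
      sgn_right hl, mul_pow, mul_pow, neg_sq, sq (sgn e (tail e)), sgn_mul_self hl.inc_left, one_mul, two_mul]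
    intro x hx
    rw [toFlow_coe, sgn_eq_zero]
    · simp
    · intro hx'
      rcases hx'.eq_or_eq_of_isLink hl with rfl | rfl <;> simp at hx
  have h2 : ∑' i : β × α, ENNReal.ofReal (toFlow h i.1 i.2 ^ 2)
      = 2 * ENNReal.ofReal (‖h‖ ^ 2) := by
    rw [ENNReal.tsum_prod (f := fun e x => ENNReal.ofReal (toFlow h e x ^ 2))]
    rw [← tsum_subtype_eq_of_support_subset (s := E(G))]
    · simp_rw [h1]
      rw [ENNReal.tsum_mul_left, ← ENNReal.ofReal_tsum_of_nonneg (fun _ => sq_nonneg _),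
        ← real_inner_self_eq_norm_sq, edgeSpace_inner_eq_tsum]
      · simp_rw [sq]
      · simpa [sq] using lp.summable_inner (𝕜 := ℝ) h h
    · intro e he
      by_contra h'
      exact he (by simp [toFlow_of_notMem _ h'])
  rw [energy, h2, mul_comm, ENNReal.mul_div_cancel_right (by simp) (by simp)]

/-- The vertex type `γ` is free so that this serves both `G` and its short networks. Finite support
matters because a `finsum` with infinite support is 0 by convention. -/
lemma source_eq_tsum_edges {γ : Type*} {θ : β → γ → ℝ} {x : γ} (hθ : ∀ e ∉ E(G), θ e x = 0)
    (hs : {e : E(G) | θ e x ≠ 0}.Finite) : source θ x = ∑' e : E(G), θ e x := by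
  have hsub : Function.support (fun e => θ e x) ⊆ E(G) := fun e he => by
    by_contra h
    exact he (hθ e h)
  rw [source, ← tsum_eq_finsum (L := SummationFilter.unconditional β)]
  · exact (tsum_subtype_eq_of_support_subset hsub).symm
  · refine (hs.image Subtype.val).subset fun e he => ⟨⟨e, hsub he⟩, he, rfl⟩

/-- Turns Kirchhoff's node law into inner products with stars. -/
lemma source_toFlow (hfin : G.IsLocallyFinite) (h : G.EdgeSpace) (x : α) :
    source (toFlow h) x = inner ℝ (starVec hfin x) h := by
  rw [source_eq_tsum_edges fun e he => toFlow_of_notMem _ he x, edgeSpace_inner_eq_tsum]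
  · exact tsum_congr fun e => by rw [toFlow_coe, starVec_apply]
  · refine (finite_support_sgn hfin x).subset fun e he h' => he ?_
    rw [toFlow_coe, h', zero_mul]

end Flow

/-! ### The edges of the finite approximations -/

section Approximation

variable {α β : Type*} {G : Graph α β}

/-- The edges with both ends in `S`. -/
def cutEdges (G : Graph α β) (S : Finset α) : Set E(G) := {e | (e : β) ∈ E(G.cutNetwork S)}

/-- The edges with at least one end in `S`. -/
def shortEdges (G : Graph α β) (S : Finset α) : Set E(G) := {e | (e : β) ∈ E(G.shortNetwork S)}

lemma collapse_of_mem {S : Finset α} {x : α} (h : x ∈ S) : collapse S x = some x := by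
  simp [collapse, h]

lemma collapse_of_notMem {S : Finset α} {x : α} (h : x ∉ S) : collapse S x = none := by
  simp [collapse, h]

lemma some_eq_collapse_iff {S : Finset α} {x y : α} :
    some y = collapse S x ↔ x ∈ S ∧ x = y := by
  unfold collapse
  split_ifs with h <;> simp [h, eq_comm]

lemma none_eq_collapse_iff {S : Finset α} {x : α} : none = collapse S x ↔ x ∉ S := by
  unfold collapse
  split_ifs with h <;> simp [h]

lemma collapse_eq_collapse_iff {S : Finset α} {x y : α} (hxy : x ≠ y) :
    collapse S x = collapse S y ↔ x ∉ S ∧ y ∉ S := by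
  unfold collapse
  split_ifs with h h' h' <;> simp [h, h', hxy]

lemma mem_cutEdges_iff {S : Finset α} {e : E(G)} {x y : α} (h : G.IsLink e x y) :
    e ∈ cutEdges G S ↔ x ∈ S ∧ y ∈ S := by
  simp only [cutEdges, cutNetwork, edgeSet_induce, Set.mem_ofPred_eq, Finset.mem_coe]
  constructor
  · rintro ⟨z, w, hzw, hz, hw⟩
    rcases h.eq_and_eq_or_eq_and_eq hzw with ⟨rfl, rfl⟩ | ⟨rfl, rfl⟩
    exacts [⟨hz, hw⟩, ⟨hw, hz⟩]
  · exact fun hS => ⟨x, y, h, hS⟩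

lemma shortNetwork_isLink_iff [G.Loopless] {S : Finset α} {e : β} {z w : Option α} :
    (G.shortNetwork S).IsLink e z w ↔
      ∃ x y, G.IsLink e x y ∧ collapse S x = z ∧ collapse S y = w ∧ z ≠ w := by
  simp only [shortNetwork, deleteEdges_isLink, map_isLink, Relation.Map, Set.mem_ofPred_eq, map_isLoopAt]
  constructor
  · rintro ⟨⟨x, y, h, rfl, rfl⟩, hl⟩
    exact ⟨x, y, h, rfl, rfl, fun hc => hl ⟨_, x, y, h, rfl, hc.symm⟩⟩
  · rintro ⟨x, y, h, rfl, rfl, hne⟩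
    refine ⟨⟨x, y, h, rfl, rfl⟩, ?_⟩
    rintro ⟨_, x', y', h', h1, h2⟩
    rcases h.eq_and_eq_or_eq_and_eq h' with ⟨rfl, rfl⟩ | ⟨rfl, rfl⟩
    exacts [hne (h1.trans h2.symm), hne (h2.trans h1.symm)]

lemma mem_shortEdges_iff [G.Loopless] {S : Finset α} {e : E(G)} {x y : α} (h : G.IsLink e x y) :
    e ∈ shortEdges G S ↔ x ∈ S ∨ y ∈ S := by
  simp only [shortEdges, Set.mem_ofPred_eq, edge_mem_iff_exists_isLink, shortNetwork_isLink_iff]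
  constructor
  · rintro ⟨z, w, x', y', h', rfl, rfl, hne⟩
    rw [Ne, collapse_eq_collapse_iff h'.ne] at hne
    rcases h.eq_and_eq_or_eq_and_eq h' with ⟨rfl, rfl⟩ | ⟨rfl, rfl⟩ <;> tauto
  · intro hS
    refine ⟨_, _, x, y, h, rfl, rfl, ?_⟩
    rw [Ne, collapse_eq_collapse_iff h.ne]
    tauto

lemma finite_shortEdges [G.Loopless] (hfin : G.IsLocallyFinite) (S : Finset α) :
    (shortEdges G S).Finite := by
  refine Set.Finite.subset (S.finite_toSet.biUnion fun x _ => finite_support_sgn hfin x) ?_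
  intro e he
  have hl := isLink_tail_head e
  rw [mem_shortEdges_iff hl] at he
  have hne : ∀ x, G.Inc e x → sgn e x ≠ 0 := fun x hx h0 => by
    have := sgn_mul_self hx
    simp [h0] at this
  simp only [Set.mem_iUnion, Finset.mem_coe, Set.mem_ofPred_eq, exists_prop]
  rcases he with he | he
  exacts [⟨_, he, hne _ hl.inc_left⟩, ⟨_, he, hne _ hl.inc_right⟩]

lemma cutEdges_subset_shortEdges [G.Loopless] (S : Finset α) : cutEdges G S ⊆ shortEdges G S :=
  fun e he => by
    have hl := isLink_tail_head e
    rw [mem_shortEdges_iff hl]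
    rw [mem_cutEdges_iff hl] at he
    exact Or.inl he.1

lemma finite_cutEdges [G.Loopless] (hfin : G.IsLocallyFinite) (S : Finset α) :
    (cutEdges G S).Finite :=
  (finite_shortEdges hfin S).subset (cutEdges_subset_shortEdges S)

lemma cutEdges_mono {S S' : Finset α} (h : S ⊆ S') : cutEdges G S ⊆ cutEdges G S' := fun e he => by
  have hl := isLink_tail_head e
  rw [mem_cutEdges_iff hl] at he ⊢
  exact ⟨h he.1, h he.2⟩

instance [G.Loopless] (hfin : G.IsLocallyFinite) (S : Finset α) :
    FiniteDimensional ℝ (cycleSpace hfin (cutEdges G S)) := by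
  have : FiniteDimensional ℝ (supported (cutEdges G S)) :=
    FiniteDimensional.span_of_finite ℝ ((finite_cutEdges hfin S).image _)
  exact Submodule.finiteDimensional_inf_left _ _

/-- The potential is 0 at both ends of an edge outside `S`, so no current runs through it. -/
lemma mem_starSpan_support [G.Loopless] {hfin : G.IsLocallyFinite} {S : Finset α} {h : G.EdgeSpace}
    (hh : h ∈ starSpan hfin Set.univ S) {e : E(G)} (he : e ∉ shortEdges G S) : h e = 0 := by
  obtain ⟨u, hu, -, hpot⟩ := exists_potential hh
  have hl := isLink_tail_head e
  rw [mem_shortEdges_iff hl, not_or] at he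
  have := hpot e _ _ (Set.mem_univ _) hl
  rwa [sgn_tail, one_mul, hu _ he.1, hu _ he.2, sub_zero] at this

/-! ### Currents in the finite approximations -/

open Classical in
lemma isUnitCurrent_cutNetwork [G.Loopless] (hfin : G.IsLocallyFinite) {S : Finset α}
    {h : G.EdgeSpace} (hh : h ∈ starSpan hfin (cutEdges G S) S) {p q : α} (hp : p ∈ S) (hq : q ∈ S)
    (hsrc : ∀ x ∈ S, inner ℝ (starVec hfin x) h =
      (if x = p then (1 : ℝ) else 0) - (if x = q then (1 : ℝ) else 0)) :
    (G.cutNetwork S).IsUnitCurrent p q (toFlow h) := by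
  obtain ⟨u, -, hF, hpot⟩ := exists_potential hh
  have hlink : ∀ {e x y}, (G.cutNetwork S).IsLink e x y → G.IsLink e x y := fun hl => hl.1
  refine ⟨⟨fun e x hx => ?_, fun e x y hl => ?_⟩, hp, hq, ⟨u, fun e x y hl => ?_⟩, fun x hx => ?_⟩
  · by_cases he : e ∈ E(G)
    · lift e to E(G) using he
      rw [toFlow_coe]
      by_cases hi : G.Inc e x
      · obtain ⟨y, hy⟩ := hi
        rw [hF e, mul_zero]
        rw [mem_cutEdges_iff hy]
        exact fun hS => hx ⟨y, hy, hS⟩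
      · rw [sgn_eq_zero hi, zero_mul]
    · exact toFlow_of_notMem _ he _
  · have he := (hlink hl).edge_mem
    lift e to E(G) using he
    rw [toFlow_coe, toFlow_coe, sgn_right (hlink hl), neg_mul]
  · have he := (hlink hl).edge_mem
    lift e to E(G) using he
    rw [toFlow_coe]
    exact hpot e x y hl.edge_mem (hlink hl)
  · rw [source_toFlow hfin]
    exact hsrc x hx

open Classical in
/-- A function on the oriented edges, seen as a flow in the short network. -/
def toShortFlow (S : Finset α) (h : E(G) → ℝ) : β → Option α → ℝ :=
  fun e z => if he : e ∈ E(G) then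
    h ⟨e, he⟩ * ((if z = collapse S (tail ⟨e, he⟩) then 1 else 0) -
      (if z = collapse S (head ⟨e, he⟩) then 1 else 0)) else 0

open Classical in
lemma toShortFlow_of_isLink [G.Loopless] (S : Finset α) (h : E(G) → ℝ) {e : E(G)} {x y : α}
    (hl : G.IsLink e x y) (z : Option α) :
    toShortFlow S h e z = sgn e x * h e * ((if z = collapse S x then 1 else 0) -
      (if z = collapse S y then 1 else 0)) := by
  have hl' := isLink_tail_head e
  rcases hl.eq_and_eq_or_eq_and_eq hl' with ⟨rfl, rfl⟩ | ⟨rfl, rfl⟩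
  · simp [toShortFlow, sgn_tail]
  · rw [sgn_right hl', sgn_tail]
    simp only [toShortFlow, Subtype.coe_eta, Subtype.coe_prop, dif_pos]
    ring

open Classical in
lemma toShortFlow_some [G.Loopless] {S : Finset α} (h : E(G) → ℝ) (e : β) {x : α} (hx : x ∈ S) :
    toShortFlow S h e (some x) = toFlow h e x := by
  by_cases he : e ∈ E(G)
  · have hite : ∀ y, (if some x = collapse S y then (1 : ℝ) else 0) = if x = y then 1 else 0 := by
      intro y
      refine if_congr ?_ rfl rfl
      rw [some_eq_collapse_iff]
      exact ⟨fun h => h.2.symm, fun h => ⟨h ▸ hx, h.symm⟩⟩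
    simp only [toShortFlow, toFlow, he, dif_pos, sgn, hite, mul_comm]
  · simp [toShortFlow, toFlow, he]

open Classical in
lemma toShortFlow_none [G.Loopless] {S : Finset α} (h : E(G) → ℝ) (e : β) :
    toShortFlow S h e none = - ∑ x ∈ S, toFlow h e x := by
  by_cases he : e ∈ E(G)
  · have hite : ∀ y, (if none = collapse S y then (1 : ℝ) else 0) = if y ∈ S then 0 else 1 := by
      intro y
      rw [if_congr none_eq_collapse_iff rfl rfl, ite_not]
    simp only [toShortFlow, toFlow, he, dif_pos, sgn, hite]
    have hsum : ∀ y, ∑ x ∈ S, (if x = y then (1 : ℝ) else 0) = if y ∈ S then 1 else 0 := by simp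
    rw [← Finset.sum_mul, Finset.sum_sub_distrib, hsum, hsum]
    split_ifs <;> simp
  · simp [toShortFlow, toFlow, he]

lemma ofShort_toShortFlow [G.Loopless] {S : Finset α} {h : E(G) → ℝ}
    (hh : ∀ e ∉ shortEdges G S, h e = 0) : G.ofShort S (toShortFlow S h) = toFlow h := by
  ext e x
  by_cases hi : G.Inc e x
  · rw [ofShort, if_pos hi]
    have he := hi.edge_mem
    lift e to E(G) using he
    obtain ⟨y, hy⟩ := hi
    rw [toShortFlow_of_isLink S h hy, toFlow_coe]
    by_cases hS : e ∈ shortEdges G S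
    · rw [mem_shortEdges_iff hy] at hS
      rw [if_pos rfl, if_neg, sub_zero, mul_one]
      rw [collapse_eq_collapse_iff hy.ne]
      tauto
    · simp [hh e hS]
  · rw [ofShort, if_neg hi]
    by_cases he : e ∈ E(G)
    · lift e to E(G) using he
      rw [toFlow_coe, sgn_eq_zero hi, zero_mul]
    · rw [toFlow_of_notMem _ he]

open Classical in
lemma isUnitCurrent_shortNetwork [G.Loopless] (hfin : G.IsLocallyFinite) {S : Finset α}
    (hSV : (S : Set α) ⊆ V(G)) {h : G.EdgeSpace} (hh : h ∈ starSpan hfin Set.univ S) {p q : α}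
    (hp : p ∈ S) (hq : q ∈ S)
    (hsrc : ∀ x ∈ S, inner ℝ (starVec hfin x) h =
      (if x = p then (1 : ℝ) else 0) - (if x = q then (1 : ℝ) else 0)) :
    (G.shortNetwork S).IsUnitCurrent (some p) (some q) (toShortFlow S h) := by
  obtain ⟨u, hu, -, hpot⟩ := exists_potential hh
  have hV : ∀ x ∈ S, some x ∈ V(G.shortNetwork S) := fun x hx =>
    ⟨x, hSV hx, collapse_of_mem hx⟩
  refine ⟨⟨fun e z hz => ?_, fun e z w hl => ?_⟩, hV p hp, hV q hq,
    -- The potential at ∞ is 0, in agreement with `u` vanishing off `S`.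
    ⟨fun z => z.elim 0 u, fun e z w hl => ?_⟩, fun z hz => ?_⟩
  · by_cases he : e ∈ E(G)
    · lift e to E(G) using he
      have hl := isLink_tail_head e
      rw [toShortFlow_of_isLink S h hl]
      by_cases hc : collapse S (tail e) = collapse S (head e)
      · simp [hc]
      · rw [if_neg, if_neg, sub_zero, mul_zero]
        · rintro rfl
          exact hz ⟨_, (shortNetwork_isLink_iff.2 ⟨_, _, hl.symm, rfl, rfl, Ne.symm hc⟩)⟩
        · rintro rfl
          exact hz ⟨_, (shortNetwork_isLink_iff.2 ⟨_, _, hl, rfl, rfl, hc⟩)⟩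
    · simp [toShortFlow, he]
  · obtain ⟨x, y, hxy, rfl, rfl, hne⟩ := shortNetwork_isLink_iff.1 hl
    have he : e ∈ E(G) := hxy.edge_mem
    lift e to E(G) using he
    rw [toShortFlow_of_isLink S h hxy, toShortFlow_of_isLink S h hxy]
    simp [hne, hne.symm]
  · obtain ⟨x, y, hxy, rfl, rfl, hne⟩ := shortNetwork_isLink_iff.1 hl
    have he : e ∈ E(G) := hxy.edge_mem
    lift e to E(G) using he
    have hel : ∀ x, (collapse S x).elim 0 u = u x := fun x => by
      by_cases hx : x ∈ S
      · simp [collapse_of_mem hx]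
      · simp [collapse_of_notMem hx, hu x hx]
    rw [toShortFlow_of_isLink S h hxy]
    beta_reduce
    rw [hel, hel, ← hpot e x y (Set.mem_univ _) hxy]
    simp [hne]
  · have hsome : ∀ x ∈ S, source (toShortFlow S h) (some x) =
        (if x = p then (1 : ℝ) else 0) - (if x = q then (1 : ℝ) else 0) := fun x hx => by
      rw [← hsrc x hx, ← source_toFlow, source, source]
      exact finsum_congr fun e => toShortFlow_some _ _ hx
    cases z with
    | some x =>
      obtain ⟨x', -, hx'⟩ := hz
      obtain ⟨hx, rfl⟩ := some_eq_collapse_iff.1 hx'.symm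
      simpa using hsome x' hx
    | none =>
      -- The node law at ∞ is not among the hypotheses: by `toShortFlow_none` the source there is
      -- minus the total over `S`, namely -(1 - 1) = 0, as `p` and `q` both lie in `S`.
      have hfs : ∀ x, {e : E(G) | toFlow h e x ≠ 0}.Finite := fun x => by
        refine (finite_support_sgn hfin x).subset fun e he h' => he ?_
        rw [toFlow_coe, h', zero_mul]
      rw [source_eq_tsum_edges (G := G) fun e he => by simp [toShortFlow, he]]
      · simp_rw [toShortFlow_none, tsum_neg]
        rw [Summable.tsum_finsetSum fun x _ => summable_of_hasFiniteSupport (hfs x)]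
        simp_rw [← source_eq_tsum_edges (fun e he => toFlow_of_notMem h he _) (hfs _),
          source_toFlow hfin]
        rw [Finset.sum_congr rfl hsrc, Finset.sum_sub_distrib]
        simp [hp, hq]
      · refine (S.finite_toSet.biUnion fun x _ => hfs x).subset fun e he => ?_
        simp only [Set.mem_ofPred_eq, toShortFlow_none, ne_eq, neg_eq_zero] at he
        obtain ⟨x, hx, hne⟩ := Finset.exists_ne_zero_of_sum_ne_zero he
        simp only [Set.mem_iUnion]
        exact ⟨x, hx, hne⟩

end Approximation

/-! ### The limit flows -/

section Limit

variable {α β : Type*} {G : Graph α β}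

/-- The closure of the finitely supported functions without sources. -/
def evenSpace (hfin : G.IsLocallyFinite) : Submodule ℝ G.EdgeSpace :=
  (⨆ S : {S : Finset α // (S : Set α) ⊆ V(G)}, cycleSpace hfin (cutEdges G S.1)).topologicalClosure

/-- The closure of the span of the stars. -/
def oddSpace (hfin : G.IsLocallyFinite) : Submodule ℝ G.EdgeSpace :=
  (⨆ S : {S : Finset α // (S : Set α) ⊆ V(G)}, starSpan hfin Set.univ S.1).topologicalClosure

instance (hfin : G.IsLocallyFinite) : (evenSpace hfin).HasOrthogonalProjection := by
  unfold evenSpace; infer_instance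

instance (hfin : G.IsLocallyFinite) : (oddSpace hfin).HasOrthogonalProjection := by
  unfold oddSpace; infer_instance

/-- The even flow between the ends of an edge, as a function on the oriented edges. -/
def evenVec (hfin : G.IsLocallyFinite) (e : E(G)) : G.EdgeSpace :=
  chi e - (evenSpace hfin).starProjection (chi e)

/-- The odd flow between the ends of an edge, as a function on the oriented edges. -/
def oddVec (hfin : G.IsLocallyFinite) (e : E(G)) : G.EdgeSpace :=
  (oddSpace hfin).starProjection (chi e)

lemma IsSwelling.tendsto_subtype {T : ℕ → Finset α} (hT : G.IsSwelling T) :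
    Tendsto (fun n => (⟨T n, hT.1 n⟩ : {S : Finset α // (S : Set α) ⊆ V(G)})) atTop atTop :=
  tendsto_atTop.2 fun S => hT.2 S.1 S.2

lemma _root_.Submodule.tendsto_starProjection_comp {ι κ H : Type*} [Preorder κ] [Preorder ι]
    [NormedAddCommGroup H] [InnerProductSpace ℝ H] [CompleteSpace H] {T : κ → ι}
    (hT : Tendsto T atTop atTop) {W : ι → Submodule ℝ H} [∀ S, (W S).HasOrthogonalProjection]
    (hW : Monotone W) (h : H) :
    Tendsto (fun n => (W (T n)).starProjection h) atTop
      (𝓝 ((⨆ S, W S).topologicalClosure.starProjection h)) :=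
  (Submodule.starProjection_tendsto_closure_iSup W hW h).comp hT

/-- Projections onto increasing subspaces converge strongly to the projection onto the closure of
their union. The limit does not involve `T`, so every swelling sequence yields the same flow. -/
lemma IsSwelling.tendsto_starProjection {T : ℕ → Finset α} (hT : G.IsSwelling T)
    {H : Type*} [NormedAddCommGroup H] [InnerProductSpace ℝ H] [CompleteSpace H]
    {W : Finset α → Submodule ℝ H} [∀ S, (W S).HasOrthogonalProjection]
    (hW : Monotone W) (h : H) :
    Tendsto (fun n => (W (T n)).starProjection h) atTop
      (𝓝 ((⨆ S : {S : Finset α // (S : Set α) ⊆ V(G)},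
        W S.1).topologicalClosure.starProjection h)) := by
  have hW' : Monotone (fun S : {S : Finset α // (S : Set α) ⊆ V(G)} => W S.1) := by
    intro S S' h
    exact hW h
  have := Submodule.tendsto_starProjection_comp hT.tendsto_subtype hW' h
  exact this

lemma starIn_mem_starSpan (hfin : G.IsLocallyFinite) (F : Set E(G)) {S : Finset α} {x : α}
    (hx : x ∈ S) : starIn hfin F x ∈ starSpan hfin F S :=
  Submodule.subset_span ⟨x, hx, rfl⟩

lemma starSpan_mono (hfin : G.IsLocallyFinite) (F : Set E(G)) : Monotone (starSpan hfin F) :=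
  fun _ _ h => Submodule.span_mono (Set.image_mono (Finset.coe_subset.2 h))

lemma cycleSpace_cutEdges_mono (hfin : G.IsLocallyFinite) :
    Monotone fun S => cycleSpace hfin (cutEdges G S) :=
  fun _ _ h => inf_le_inf_right _ (Submodule.span_mono (Set.image_mono (cutEdges_mono h)))

lemma inner_starVec_of_mem_cutSupported [G.Loopless] (hfin : G.IsLocallyFinite) {S : Finset α}
    {h : G.EdgeSpace} (hh : ∀ e ∉ cutEdges G S, h e = 0) {x : α} (hx : x ∉ S) :
    inner ℝ (starVec hfin x) h = 0 := by
  rw [edgeSpace_inner_eq_tsum]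
  refine (tsum_congr fun e => ?_).trans tsum_zero
  by_cases hi : G.Inc e x
  · obtain ⟨y, hy⟩ := hi
    rw [hh e, mul_zero]
    rw [mem_cutEdges_iff hy]
    exact fun h => hx h.1
  · rw [starVec_apply, sgn_eq_zero hi, zero_mul]

lemma starSpan_le_orthogonal_cycleSpace [G.Loopless] (hfin : G.IsLocallyFinite) (S S' : Finset α) :
    starSpan hfin (cutEdges G S) S' ≤ (cycleSpace hfin (cutEdges G S))ᗮ := by
  refine Submodule.span_le.2 ?_
  rintro _ ⟨x, -, rfl⟩
  rw [SetLike.mem_coe, Submodule.mem_orthogonal']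
  intro h hh
  rw [mem_cycleSpace_iff] at hh
  rw [inner_starIn _ _ _ _ ((mem_supported_iff (finite_cutEdges hfin S)).1 hh.1), hh.2 x]

/-- In the finite network, gradients and cycles are orthogonal complements: what remains of `chi e`
after projecting to the stars is supported in the cut network and orthogonal to its stars, hence is
a cycle. The left side shows the current to be a gradient; the right side is the form that passes to
the limit. -/
lemma starProjection_starSpan_cutEdges [G.Loopless] (hfin : G.IsLocallyFinite) {S : Finset α}
    {e : E(G)} (he : e ∈ cutEdges G S) :
    (starSpan hfin (cutEdges G S) S).starProjection (chi e) =
      chi e - (cycleSpace hfin (cutEdges G S)).starProjection (chi e) := by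
  set B := starSpan hfin (cutEdges G S) S
  have hB : B.starProjection (chi e) ∈ B := Submodule.starProjection_apply_mem _ _
  have hsupp : ∀ f ∉ cutEdges G S, (chi e - B.starProjection (chi e)) f = 0 := fun f hf => by
    obtain ⟨u, -, hF, -⟩ := exists_potential hB
    rw [lp.coeFn_sub, Pi.sub_apply, hF f hf, chi_apply, if_neg, sub_zero]
    rintro rfl
    exact hf he
  rw [Submodule.eq_starProjection_of_mem_orthogonal (K := cycleSpace hfin (cutEdges G S))
    (u := chi e) (v := chi e - B.starProjection (chi e)), sub_sub_cancel]
  · refine mem_cycleSpace_iff.2 ⟨(mem_supported_iff (finite_cutEdges hfin S)).2 hsupp, fun x => ?_⟩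
    -- The node law at a vertex of `S` comes from the projection; at other points the star misses
    -- the support.
    by_cases hx : x ∈ S
    · rw [← inner_starIn hfin _ _ _ hsupp]
      exact Submodule.inner_right_of_mem_orthogonal (starIn_mem_starSpan hfin _ hx)
        (Submodule.sub_starProjection_mem_orthogonal _)
    · exact inner_starVec_of_mem_cutSupported hfin hsupp hx
  · rw [sub_sub_cancel]
    exact starSpan_le_orthogonal_cycleSpace hfin S S hB

-- The unit flow along the single edge `e` already has the sources required of a current from `p` to
-- `q`; removing a cycle leaves them unchanged.
open Classical in
lemma inner_starVec_chi [G.Loopless] (hfin : G.IsLocallyFinite) {e : E(G)} {p q : α}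
    (hl : G.IsLink e p q) (x : α) : inner ℝ (starVec hfin x) (sgn e p • chi e) =
      (if x = p then (1 : ℝ) else 0) - (if x = q then (1 : ℝ) else 0) := by
  rw [inner_smul_right, inner_chi_right, starVec_apply, sgn_mul_sgn hl]

lemma isEvenFlow_evenVec [G.Loopless] (hfin : G.IsLocallyFinite) {e : E(G)} {p q : α}
    (hl : G.IsLink e p q) : G.IsEvenFlow p q (toFlow (sgn e p • evenVec hfin e : G.EdgeSpace)) := by
  classical
  intro T hT
  have hev : ∀ᶠ n in atTop, p ∈ T n ∧ q ∈ T n := by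
    filter_upwards [hT.2 {p, q} (by
      simp [Set.insert_subset_iff, hl.left_mem, hl.right_mem])] with n hn
    exact ⟨hn (by simp), hn (by simp)⟩
  refine ⟨fun n => toFlow (sgn e p • (chi e -
    (cycleSpace hfin (cutEdges G (T n))).starProjection (chi e)) : G.EdgeSpace), ?_, ?_⟩
  · filter_upwards [hev] with n hn
    have he : e ∈ cutEdges G (T n) := (mem_cutEdges_iff hl).2 hn
    have hmem := Submodule.starProjection_apply_mem (starSpan hfin (cutEdges G (T n)) (T n)) (chi e)
    rw [starProjection_starSpan_cutEdges hfin he] at hmem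
    refine isUnitCurrent_cutNetwork hfin (Submodule.smul_mem _ _ hmem) hn.1 hn.2 fun x _ => ?_
    rw [smul_sub, inner_sub_right, inner_starVec_chi hfin hl, inner_smul_right,
      (mem_cycleSpace_iff.1 (Submodule.starProjection_apply_mem _ _)).2 x, mul_zero, sub_zero]
  · have hlim := hT.tendsto_starProjection (cycleSpace_cutEdges_mono hfin) (chi e)
    have hlim2 := ((hlim.const_sub (chi e)).const_smul (sgn e p)).sub_const
      (sgn e p • evenVec hfin e)
    have : Tendsto (fun n => ENNReal.ofReal (‖sgn e p • (chi e -
        (cycleSpace hfin (cutEdges G (T n))).starProjection (chi e)) -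
          sgn e p • evenVec hfin e‖ ^ 2)) atTop (𝓝 0) := by
      have h0 := ENNReal.tendsto_ofReal (hlim2.norm.pow 2)
      simpa [evenVec, evenSpace] using h0
    refine this.congr fun n => ?_
    rw [← energy_toFlow, lp.coeFn_sub, toFlow_sub]

lemma isOddFlow_oddVec [G.Loopless] (hfin : G.IsLocallyFinite) {e : E(G)} {p q : α}
    (hl : G.IsLink e p q) : G.IsOddFlow p q (toFlow (sgn e p • oddVec hfin e : G.EdgeSpace)) := by
  classical
  intro T hT
  have hev : ∀ᶠ n in atTop, p ∈ T n ∧ q ∈ T n := by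
    filter_upwards [hT.2 {p, q} (by
      simp [Set.insert_subset_iff, hl.left_mem, hl.right_mem])] with n hn
    exact ⟨hn (by simp), hn (by simp)⟩
  have hmem : ∀ n, sgn e p • (starSpan hfin Set.univ (T n)).starProjection (chi e) ∈
      starSpan hfin Set.univ (T n) := fun n =>
    Submodule.smul_mem _ _ (Submodule.starProjection_apply_mem _ _)
  refine ⟨fun n => toShortFlow (T n) (sgn e p •
    (starSpan hfin Set.univ (T n)).starProjection (chi e) : G.EdgeSpace), ?_, ?_⟩
  · filter_upwards [hev] with n hn
    refine isUnitCurrent_shortNetwork hfin (hT.1 n) (hmem n) hn.1 hn.2 fun x hx => ?_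
    -- Projecting to the span of the stars of `S` preserves inner products with those stars, hence
    -- the sources at vertices of `S`.
    rw [← inner_starVec_chi hfin hl, ← map_smul]
    have := Submodule.inner_right_of_mem_orthogonal
      (starIn_mem_starSpan hfin Set.univ hx)
      (Submodule.sub_starProjection_mem_orthogonal (sgn e p • chi e))
    rw [inner_sub_right] at this
    linarith
  · have hlim := hT.tendsto_starProjection (starSpan_mono hfin Set.univ) (chi e)
    have hlim2 := (hlim.const_smul (sgn e p)).sub_const (sgn e p • oddVec hfin e)
    have : Tendsto (fun n => ENNReal.ofReal (‖sgn e p •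
        (starSpan hfin Set.univ (T n)).starProjection (chi e) -
          sgn e p • oddVec hfin e‖ ^ 2)) atTop (𝓝 0) := by
      have h0 := ENNReal.tendsto_ofReal (hlim2.norm.pow 2)
      simpa [oddVec, oddSpace] using h0
    refine this.congr fun n => ?_
    rw [← energy_toFlow, lp.coeFn_sub, toFlow_sub,
      ofShort_toShortFlow fun f hf => mem_starSpan_support (hmem n) hf]

lemma norm_sgn_smul_sq [G.Loopless] {e : E(G)} {p : α} (hp : G.Inc e p) (h : G.EdgeSpace) :
    ‖sgn e p • h‖ ^ 2 = ‖h‖ ^ 2 := by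
  rw [norm_smul, mul_pow, Real.norm_eq_abs, sq_abs, sq, sgn_mul_self hp, one_mul]

lemma isEvenResistance_edge [G.Loopless] (hfin : G.IsLocallyFinite) {e : E(G)} {p q : α}
    (hl : G.IsLink e p q) : G.IsEvenResistance p q (‖evenVec hfin e‖ ^ 2) := by
  refine ⟨_, isEvenFlow_evenVec hfin hl, ?_, ?_⟩ <;>
    rw [energy_toFlow, norm_sgn_smul_sq hl.inc_left]
  · exact ENNReal.ofReal_ne_top
  · rw [ENNReal.toReal_ofReal (sq_nonneg _)]

lemma isOddResistance_edge [G.Loopless] (hfin : G.IsLocallyFinite) {e : E(G)} {p q : α}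
    (hl : G.IsLink e p q) : G.IsOddResistance p q (‖oddVec hfin e‖ ^ 2) := by
  refine ⟨_, isOddFlow_oddVec hfin hl, ?_, ?_⟩ <;>
    rw [energy_toFlow, norm_sgn_smul_sq hl.inc_left]
  · exact ENNReal.ofReal_ne_top
  · rw [ENNReal.toReal_ofReal (sq_nonneg _)]

end Limit

/-! ### Foster's identity and its consequences -/

section Foster

variable {α β : Type*} {G : Graph α β}

lemma norm_sq_starProjection_eq_sum {H ι : Type*} [NormedAddCommGroup H] [InnerProductSpace ℝ H]
    [Fintype ι] {K : Submodule ℝ H} [K.HasOrthogonalProjection] (b : OrthonormalBasis ι ℝ K)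
    (x : H) : ‖K.starProjection x‖ ^ 2 = ∑ i, (inner ℝ (b i : H) x) ^ 2 := by
  rw [Submodule.starProjection_apply, ← Submodule.coe_norm, ← b.sum_sq_norm_inner_right]
  refine Finset.sum_congr rfl fun i _ => ?_
  rw [Submodule.inner_orthogonalProjectionOnto_eq_of_mem_left, Real.norm_eq_abs, sq_abs]

lemma norm_sq_eq_tsum (h : G.EdgeSpace) : ‖h‖ ^ 2 = ∑' e, h e ^ 2 := by
  rw [← real_inner_self_eq_norm_sq, edgeSpace_inner_eq_tsum]
  simp_rw [sq]

lemma summable_sq (h : G.EdgeSpace) : Summable fun e => h e ^ 2 := by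
  simpa [sq] using lp.summable_inner (𝕜 := ℝ) h h

/-- The part of the trace of the projection seen by `F`. Each basis vector has norm 1, so each inner
sum is at most 1, with equality when `K` is supported in `F`; this gives the two bounds on the
dimension that follow. -/
lemma sum_norm_sq_starProjection_chi (K : Submodule ℝ G.EdgeSpace) [FiniteDimensional ℝ K]
    (F : Finset E(G)) :
    ∑ e ∈ F, ‖K.starProjection (chi e)‖ ^ 2 =
      ∑ i, ∑ e ∈ F, (stdOrthonormalBasis ℝ K i : G.EdgeSpace) e ^ 2 := by
  rw [Finset.sum_comm]
  refine Finset.sum_congr rfl fun e _ => ?_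
  rw [norm_sq_starProjection_eq_sum (stdOrthonormalBasis ℝ K)]
  simp_rw [inner_chi_right]

lemma norm_sq_stdOrthonormalBasis (K : Submodule ℝ G.EdgeSpace) [FiniteDimensional ℝ K]
    (i : Fin (Module.finrank ℝ K)) : ‖(stdOrthonormalBasis ℝ K i : G.EdgeSpace)‖ ^ 2 = 1 := by
  rw [← Submodule.coe_norm, (stdOrthonormalBasis ℝ K).norm_eq_one, one_pow]

lemma sum_norm_sq_starProjection_chi_le (K : Submodule ℝ G.EdgeSpace) [FiniteDimensional ℝ K]
    (F : Finset E(G)) :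
    ∑ e ∈ F, ‖K.starProjection (chi e)‖ ^ 2 ≤ Module.finrank ℝ K := by
  rw [sum_norm_sq_starProjection_chi]
  refine (Finset.sum_le_card_nsmul _ _ 1 fun i _ => ?_).trans (by simp)
  rw [← norm_sq_stdOrthonormalBasis K i, norm_sq_eq_tsum]
  exact (summable_sq _).sum_le_tsum _ fun _ _ => sq_nonneg _

lemma finrank_le_sum_norm_sq_starProjection_chi (K : Submodule ℝ G.EdgeSpace)
    [FiniteDimensional ℝ K] (F : Finset E(G)) (hF : ∀ h ∈ K, ∀ e ∉ F, h e = 0) :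
    Module.finrank ℝ K ≤ ∑ e ∈ F, ‖K.starProjection (chi e)‖ ^ 2 := by
  rw [sum_norm_sq_starProjection_chi]
  refine le_trans (by simp) (Finset.card_nsmul_le_sum _ _ 1 fun i _ => ?_)
  rw [← norm_sq_stdOrthonormalBasis K i, norm_sq_eq_tsum, tsum_eq_sum]
  intro e he
  rw [hF _ (Subtype.coe_prop _) e he]
  simp

/-- A linear relation is a potential vanishing off `S` with zero gradient. It is constant by
connectedness, and 0 because some vertex lies outside the finite set `S`. -/
lemma linearIndependent_starVec [G.Loopless] (hfin : G.IsLocallyFinite) (hinf : V(G).Infinite)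
    (hconn : G.IsConnected) {S : Finset α} (hS : (S : Set α) ⊆ V(G)) :
    LinearIndependent ℝ fun x : S => starVec hfin (x : α) := by
  classical
  rw [Fintype.linearIndependent_iff]
  intro g hg
  set u : α → ℝ := fun x => if hx : x ∈ S then g ⟨x, hx⟩ else 0 with hu
  have hadj : ∀ x y, G.Adj x y → u x = u y := by
    rintro x y ⟨e, hl⟩
    have he := hl.edge_mem
    lift e to E(G) using he
    have h1 : ∑ z ∈ S, u z * sgn e z = 0 := by
      have := congrArg (fun h : G.EdgeSpace => h e) hg
      simp only [lp.coeFn_sum, Finset.sum_apply, lp.coeFn_smul, Pi.smul_apply, starVec_apply,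
        smul_eq_mul, lp.coeFn_zero, Pi.zero_apply] at this
      rw [← this, ← Finset.sum_coe_sort]
      refine Finset.sum_congr rfl fun z _ => ?_
      simp [hu]
    have h2 : ∑ z ∈ S, u z * (sgn e x * sgn e z) = 0 := by
      rw [← mul_zero (sgn e x), ← h1, Finset.mul_sum]
      exact Finset.sum_congr rfl fun z _ => by ring
    simp_rw [sgn_mul_sgn hl, mul_sub, Finset.sum_sub_distrib, mul_ite, mul_one, mul_zero,
      Finset.sum_ite_eq'] at h2
    have h3 : ∀ x, (if x ∈ S then u x else 0) = u x := fun x => by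
      split_ifs with hx
      · rfl
      · simp [hu, hx]
    rw [h3, h3] at h2
    linarith
  obtain ⟨y, hy, hyS⟩ := hinf.exists_notMem_finset S
  rintro ⟨x, hx⟩
  have h4 : u x = u y := by
    have := hconn.2 x (hS hx) y hy
    clear hy hyS
    induction this with
    | refl => rfl
    | tail _ h ih => exact ih.trans (hadj _ _ h)
  simpa [hu, hx, hyS] using h4

lemma finrank_starSpan_le (hfin : G.IsLocallyFinite) (F : Set E(G)) (S : Finset α) :
    Module.finrank ℝ (starSpan hfin F S) ≤ S.card := by
  classical
  have := finrank_span_finset_le_card (R := ℝ) (S.image (starIn hfin F))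
  rw [Finset.coe_image] at this
  exact this.trans Finset.card_image_le

lemma finrank_starSpan_univ [G.Loopless] (hfin : G.IsLocallyFinite) (hinf : V(G).Infinite)
    (hconn : G.IsConnected) {S : Finset α} (hS : (S : Set α) ⊆ V(G)) :
    Module.finrank ℝ (starSpan hfin Set.univ S) = S.card := by
  have := finrank_span_eq_card (linearIndependent_starVec hfin hinf hconn hS)
  rw [Fintype.card_coe] at this
  rw [← this, starSpan, Set.image_eq_range]
  rfl

lemma norm_sub_starProjection_le {H : Type*} [NormedAddCommGroup H] [InnerProductSpace ℝ H]
    (K : Submodule ℝ H) [K.HasOrthogonalProjection] (x : H) {y : H} (hy : y ∈ K) :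
    ‖x - K.starProjection x‖ ≤ ‖x - y‖ := by
  rw [Submodule.starProjection_minimal]
  exact ciInf_le ⟨0, Set.forall_mem_range.mpr fun _ => norm_nonneg _⟩ (⟨y, hy⟩ : K)

lemma cycleSpace_le_evenSpace (hfin : G.IsLocallyFinite) {S : Finset α} (hS : (S : Set α) ⊆ V(G)) :
    cycleSpace hfin (cutEdges G S) ≤ evenSpace hfin :=
  (le_iSup (fun S : {S : Finset α // (S : Set α) ⊆ V(G)} => cycleSpace hfin (cutEdges G S.1))
    ⟨S, hS⟩).trans (Submodule.le_topologicalClosure _)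

lemma starSpan_le_oddSpace (hfin : G.IsLocallyFinite) {S : Finset α} (hS : (S : Set α) ⊆ V(G)) :
    starSpan hfin Set.univ S ≤ oddSpace hfin :=
  (le_iSup (fun S : {S : Finset α // (S : Set α) ⊆ V(G)} => starSpan hfin Set.univ S.1)
    ⟨S, hS⟩).trans (Submodule.le_topologicalClosure _)

lemma evenSpace_le_orthogonal_oddSpace (hfin : G.IsLocallyFinite) :
    evenSpace hfin ≤ (oddSpace hfin)ᗮ := by
  refine Submodule.topologicalClosure_minimal _ (iSup_le fun S => ?_) (Submodule.isClosed_orthogonal _)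
  rw [oddSpace, Submodule.orthogonal_closure, ← Submodule.iInf_orthogonal]
  refine le_iInf fun S' => inf_le_right.trans (Submodule.orthogonal_le ?_)
  exact Submodule.span_mono (Set.image_subset_range _ _)

/-- Since Z is orthogonal to B, subtracting a vector of Z does not alter the projection to B: the
odd flow is the projection of the even flow. -/
lemma norm_oddVec_le_norm_evenVec (hfin : G.IsLocallyFinite) (e : E(G)) :
    ‖oddVec hfin e‖ ≤ ‖evenVec hfin e‖ := by
  have h : oddVec hfin e = (oddSpace hfin).starProjection (evenVec hfin e) := by
    rw [evenVec, map_sub, oddVec, eq_comm, sub_eq_self]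
    refine (Submodule.starProjection_apply_eq_zero_iff _).2 ?_
    exact evenSpace_le_orthogonal_oddSpace hfin (Submodule.starProjection_apply_mem _ _)
  rw [h]
  exact Submodule.norm_starProjection_apply_le _ _

lemma norm_oddVec_le_one (hfin : G.IsLocallyFinite) (e : E(G)) : ‖oddVec hfin e‖ ≤ 1 :=
  (Submodule.norm_starProjection_apply_le _ _).trans (norm_chi e).le

/-- Rayleigh monotonicity: the distance from `chi e` to Z is at most its distance to the cycles of
the cut network, and Foster's identity bounds the sum of the squares of the latter. -/
lemma sum_evenVec_le [G.Loopless] (hfin : G.IsLocallyFinite) {S : Finset α}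
    (hS : (S : Set α) ⊆ V(G)) :
    ∑ e ∈ (finite_cutEdges hfin S).toFinset, ‖evenVec hfin e‖ ^ 2 ≤ S.card := by
  refine le_trans (Finset.sum_le_sum fun e he => ?_)
    ((sum_norm_sq_starProjection_chi_le (starSpan hfin (cutEdges G S) S) _).trans
      (Nat.cast_le.2 (finrank_starSpan_le hfin _ S)))
  rw [starProjection_starSpan_cutEdges hfin (by simpa using he)]
  gcongr
  exact norm_sub_starProjection_le _ _
    (cycleSpace_le_evenSpace hfin hS (Submodule.starProjection_apply_mem _ _))

/-- The span of the stars of `S` lies in B, so the current in the short network is a projection of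
the odd flow and has no more energy; Foster's identity evaluates the finite side as |S|. -/
lemma card_le_sum_oddVec [G.Loopless] (hfin : G.IsLocallyFinite) (hinf : V(G).Infinite)
    (hconn : G.IsConnected) {S : Finset α} (hS : (S : Set α) ⊆ V(G)) :
    S.card ≤ ∑ e ∈ (finite_shortEdges hfin S).toFinset, ‖oddVec hfin e‖ ^ 2 := by
  rw [← finrank_starSpan_univ hfin hinf hconn hS]
  refine (finrank_le_sum_norm_sq_starProjection_chi _ (finite_shortEdges hfin S).toFinset
    fun h hh e he => mem_starSpan_support hh (by simpa using he)).trans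
    (Finset.sum_le_sum fun e _ => ?_)
  gcongr
  have : (starSpan hfin Set.univ S).starProjection (chi e) =
      (starSpan hfin Set.univ S).starProjection (oddVec hfin e) := by
    rw [oddVec, ← ContinuousLinearMap.comp_apply,
      Submodule.starProjection_comp_starProjection_of_le (starSpan_le_oddSpace hfin hS)]
  rw [this]
  exact Submodule.norm_starProjection_apply_le _ _

lemma ncard_edgeBoundary [G.Loopless] (S : Finset α) :
    (G.edgeBoundary S).ncard = (shortEdges G S \ cutEdges G S).ncard := by
  rw [← Set.ncard_image_of_injective _ Subtype.val_injective]
  congr 1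
  ext e
  simp only [edgeBoundary, Set.mem_ofPred_eq, Set.mem_image, Set.mem_sdiff]
  constructor
  · rintro ⟨x, hx, y, hy, hl⟩
    exact ⟨⟨e, hl.edge_mem⟩, by rw [mem_shortEdges_iff hl, mem_cutEdges_iff hl]; tauto, rfl⟩
  · rintro ⟨e, he, rfl⟩
    have hl := isLink_tail_head e
    rw [mem_shortEdges_iff hl, mem_cutEdges_iff hl] at he
    by_cases ht : tail e ∈ S
    · exact ⟨_, ht, _, fun h => he.2 ⟨ht, h⟩, hl⟩
    · exact ⟨_, he.1.resolve_left ht, _, ht, hl.symm⟩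

lemma card_le_sum_oddVec_add [G.Loopless] (hfin : G.IsLocallyFinite) (hinf : V(G).Infinite)
    (hconn : G.IsConnected) {S : Finset α} (hS : (S : Set α) ⊆ V(G)) :
    S.card ≤ ∑ e ∈ (finite_cutEdges hfin S).toFinset, ‖oddVec hfin e‖ ^ 2 +
      (G.edgeBoundary S).ncard := by
  classical
  refine (card_le_sum_oddVec hfin hinf hconn hS).trans ?_
  have hsub : (finite_cutEdges hfin S).toFinset ⊆ (finite_shortEdges hfin S).toFinset := by
    simpa using cutEdges_subset_shortEdges S
  rw [← Finset.sum_sdiff hsub, add_comm, ncard_edgeBoundary,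
    Set.ncard_eq_toFinset_card _ ((finite_shortEdges hfin S).sdiff)]
  gcongr
  refine (Finset.sum_le_card_nsmul _ _ 1 fun e _ => ?_).trans_eq ?_
  · exact pow_le_one₀ (norm_nonneg _) (norm_oddVec_le_one hfin e)
  · rw [nsmul_eq_mul, mul_one]
    congr 2
    ext e
    simp

end Foster

/-! ### Invariance under symmetries -/

section Invariance

variable {α β : Type*} {G : Graph α β}

/-- The tail of an edge, as an element of the vertex set. -/
def tailV (e : E(G)) : V(G) := ⟨tail e, (isLink_tail_head e).left_mem⟩

/-- The head of an edge, as an element of the vertex set. -/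
def headV (e : E(G)) : V(G) := ⟨head e, (isLink_tail_head e).right_mem⟩

namespace Symmetry

lemma isLink_tail_head (s : G.Symmetry) (e : E(G)) :
    G.IsLink (s.onE e) (s.onV (tailV e)) (s.onV (headV e)) :=
  (s.isLink_iff e (tailV e) (headV e)).2 (Graph.isLink_tail_head e)

/-- The sign that says whether a symmetry preserves the orientation of an edge. -/
def sign (s : G.Symmetry) (e : E(G)) : ℝ := sgn (s.onE e) (s.onV (tailV e))

lemma sign_mul_self [G.Loopless] (s : G.Symmetry) (e : E(G)) : s.sign e * s.sign e = 1 :=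
  sgn_mul_self (s.isLink_tail_head e).inc_left

lemma sgn_onE_onV [G.Loopless] (s : G.Symmetry) (e : E(G)) (x : V(G)) :
    sgn (s.onE e) (s.onV x) = s.sign e * sgn e x := by
  classical
  have h1 := sgn_mul_sgn (s.isLink_tail_head e) (s.onV x)
  have h2 : sgn e x = s.sign e * sgn (s.onE e) (s.onV x) := by
    rw [sign, h1, sgn]
    congr 1
    · refine if_congr ?_ rfl rfl
      rw [Subtype.coe_inj, s.onV.apply_eq_iff_eq, Subtype.ext_iff, tailV]
    · refine if_congr ?_ rfl rfl
      rw [Subtype.coe_inj, s.onV.apply_eq_iff_eq, Subtype.ext_iff, headV]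
  rw [h2, ← mul_assoc, sign_mul_self, one_mul]

/-- The action of a symmetry on the functions on the oriented edges. -/
def act [G.Loopless] (s : G.Symmetry) : G.EdgeSpace →ₗᵢ[ℝ] G.EdgeSpace where
  toFun h := ⟨fun f => s.sign (s.onE.symm f) * h (s.onE.symm f), by
    have h1 : Summable fun f => h (s.onE.symm f) ^ 2 :=
      (s.onE.symm.summable_iff (f := fun e => h e ^ 2)).2 (summable_sq h)
    refine (memℓp_gen_iff (by norm_num)).2 (h1.congr fun f => ?_)
    simp only [ENNReal.toReal_ofNat, Real.rpow_ofNat, Real.norm_eq_abs, sq_abs]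
    rw [mul_pow, sq (s.sign _), sign_mul_self, one_mul]⟩
  map_add' h k := by
    ext f
    exact mul_add _ _ _
  map_smul' c h := by
    ext f
    simp [mul_left_comm]
  norm_map' h := by
    refine (sq_eq_sq₀ (norm_nonneg _) (norm_nonneg _)).1 ?_
    rw [norm_sq_eq_tsum, norm_sq_eq_tsum, ← s.onE.symm.tsum_eq fun e => h e ^ 2]
    refine tsum_congr fun f => ?_
    simp [mul_pow, sq (s.sign _), sign_mul_self]

lemma act_apply [G.Loopless] (s : G.Symmetry) (h : G.EdgeSpace) (f : E(G)) :
    s.act h f = s.sign (s.onE.symm f) * h (s.onE.symm f) := rfl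

lemma act_chi [G.Loopless] (s : G.Symmetry) (e : E(G)) :
    s.act (chi e) = s.sign e • chi (s.onE e) := by
  classical
  ext f
  rw [act_apply, lp.coeFn_smul, Pi.smul_apply, chi_apply, chi_apply, smul_eq_mul]
  by_cases h : f = s.onE e
  · subst h
    simp
  · rw [if_neg h, if_neg, mul_zero, mul_zero]
    rwa [Equiv.symm_apply_eq]

lemma act_starVec [G.Loopless] (hfin : G.IsLocallyFinite) (s : G.Symmetry) (x : V(G)) :
    s.act (starVec hfin x) = starVec hfin (s.onV x : α) := by
  ext f
  rw [act_apply, starVec_apply, starVec_apply, ← sgn_onE_onV, Equiv.apply_symm_apply]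

lemma mem_oddSpace [G.Loopless] (hfin : G.IsLocallyFinite) (s : G.Symmetry) {h : G.EdgeSpace}
    (hh : h ∈ oddSpace hfin) : s.act h ∈ oddSpace hfin := by
  suffices oddSpace hfin ≤ (oddSpace hfin).comap s.act.toLinearMap from this hh
  refine Submodule.topologicalClosure_minimal _ (iSup_le fun S => Submodule.span_le.2 ?_)
    ((Submodule.isClosed_topologicalClosure _).preimage s.act.continuous)
  rintro _ ⟨x, hx, rfl⟩
  have hx' := s.act_starVec hfin ⟨x, S.2 hx⟩
  change s.act (starVec hfin x) ∈ oddSpace hfin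
  rw [hx']
  refine starSpan_le_oddSpace hfin (S := {(s.onV ⟨x, S.2 hx⟩ : α)}) (by simp) ?_
  exact starIn_mem_starSpan hfin _ (by simp)

lemma mem_evenSpace [G.Loopless] (hfin : G.IsLocallyFinite) (s : G.Symmetry) {h : G.EdgeSpace}
    (hh : h ∈ evenSpace hfin) : s.act h ∈ evenSpace hfin := by
  classical
  suffices evenSpace hfin ≤ (evenSpace hfin).comap s.act.toLinearMap from this hh
  refine Submodule.topologicalClosure_minimal _ (iSup_le fun S k hk => ?_)
    ((Submodule.isClosed_topologicalClosure _).preimage s.act.continuous)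
  change s.act k ∈ evenSpace hfin
  rw [mem_cycleSpace_iff, mem_supported_iff (finite_cutEdges hfin _)] at hk
  set S' : Finset α := (S.1.subtype (· ∈ V(G))).image fun x => (s.onV x : α) with hS'
  have hmem : ∀ x : V(G), (x : α) ∈ S.1 → (s.onV x : α) ∈ S' := fun x hx => by
    rw [hS', Finset.mem_image]
    exact ⟨x, by simpa using hx, rfl⟩
  have hS'V : (S' : Set α) ⊆ V(G) := by
    intro x hx
    rw [hS', Finset.mem_coe, Finset.mem_image] at hx
    obtain ⟨y, -, rfl⟩ := hx
    exact Subtype.coe_prop _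
  refine cycleSpace_le_evenSpace hfin hS'V (mem_cycleSpace_iff.2
    ⟨(mem_supported_iff (finite_cutEdges hfin _)).2 fun f hf => ?_, fun x => ?_⟩)
  · rw [act_apply, hk.1, mul_zero]
    intro he
    rw [mem_cutEdges_iff (Graph.isLink_tail_head _)] at he
    refine hf ?_
    have hl := s.isLink_tail_head (s.onE.symm f)
    rw [Equiv.apply_symm_apply] at hl
    exact (mem_cutEdges_iff hl).2 ⟨hmem _ he.1, hmem _ he.2⟩
  · by_cases hx : x ∈ V(G)
    · have := s.act_starVec hfin (s.onV.symm ⟨x, hx⟩)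
      rw [Equiv.apply_symm_apply] at this
      rw [← this, LinearIsometry.inner_map_map, hk.2]
    · have : starVec hfin x = 0 := by
        ext f
        rw [starVec_apply, sgn_eq_zero fun h => hx h.vertex_mem]
        rfl
      rw [this, inner_zero_left]

/-- The image under `s` of the best approximation to `chi e`, with the right sign, competes for `chi
(s.onE e)`. The inverse symmetry gives the reverse inequality. -/
lemma norm_sub_starProjection_onE_le [G.Loopless] (s : G.Symmetry) (K : Submodule ℝ G.EdgeSpace)
    [K.HasOrthogonalProjection] (hK : ∀ h ∈ K, s.act h ∈ K) (e : E(G)) :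
    ‖chi (s.onE e) - K.starProjection (chi (s.onE e))‖ ≤ ‖chi e - K.starProjection (chi e)‖ := by
  have h1 : chi (s.onE e) = s.sign e • s.act (chi e) := by
    rw [act_chi, smul_smul, sign_mul_self, one_smul]
  have hsign : ‖s.sign e‖ = 1 := by
    have h := congrArg norm (s.sign_mul_self e)
    rw [norm_mul, norm_one] at h
    nlinarith [norm_nonneg (s.sign e)]
  refine (norm_sub_starProjection_le K _
    (K.smul_mem (s.sign e) (hK _ (K.starProjection_apply_mem (chi e))))).trans_eq ?_
  rw [h1, ← smul_sub, ← map_sub, norm_smul, hsign, one_mul, LinearIsometry.norm_map]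

lemma norm_sub_starProjection_onE [G.Loopless] (s : G.Symmetry) (K : Submodule ℝ G.EdgeSpace)
    [K.HasOrthogonalProjection] (hK : ∀ (s : G.Symmetry), ∀ h ∈ K, s.act h ∈ K) (e : E(G)) :
    ‖chi (s.onE e) - K.starProjection (chi (s.onE e))‖ = ‖chi e - K.starProjection (chi e)‖ := by
  refine le_antisymm (s.norm_sub_starProjection_onE_le K (hK s) e) ?_
  have h := s.symm.norm_sub_starProjection_onE_le K (hK s.symm) (s.onE e)
  have he : s.symm.onE (s.onE e) = e := s.onE.symm_apply_apply e
  rwa [he] at h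

lemma norm_evenVec_onE [G.Loopless] (hfin : G.IsLocallyFinite) (s : G.Symmetry) (e : E(G)) :
    ‖evenVec hfin (s.onE e)‖ = ‖evenVec hfin e‖ :=
  s.norm_sub_starProjection_onE _ (fun s _ h => s.mem_evenSpace hfin h) e

lemma norm_sq_oddVec_onE [G.Loopless] (hfin : G.IsLocallyFinite) (s : G.Symmetry) (e : E(G)) :
    ‖oddVec hfin (s.onE e)‖ ^ 2 = ‖oddVec hfin e‖ ^ 2 := by
  -- Pythagoras reduces the length of the projection to the distance from B, whose invariance is
  -- known.
  have h : ∀ e : E(G), ‖oddVec hfin e‖ ^ 2 =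
      1 - ‖chi e - (oddSpace hfin).starProjection (chi e)‖ ^ 2 := fun e => by
    have := Submodule.norm_sq_eq_add_norm_sq_starProjection (chi e) (oddSpace hfin)
    rw [norm_chi, Submodule.starProjection_orthogonal_val] at this
    rw [oddVec]
    linarith
  rw [h, h, s.norm_sub_starProjection_onE _ fun s _ h => s.mem_oddSpace hfin h]

end Symmetry

end Invariance

/-! ### Counting incidences -/

section Incidence

variable {α β : Type*} {G : Graph α β}

/-- The vertices in `S`. -/
def vertexFinset (G : Graph α β) (S : Finset α) : Finset V(G) := by
  classical exact S.subtype (· ∈ V(G))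

@[simp] lemma mem_vertexFinset {S : Finset α} {v : V(G)} :
    v ∈ vertexFinset G S ↔ (v : α) ∈ S := by
  simp [vertexFinset]

lemma card_vertexFinset {S : Finset α} (hS : (S : Set α) ⊆ V(G)) :
    (vertexFinset G S).card = S.card := by
  classical
  rw [vertexFinset, Finset.card_subtype, Finset.filter_true_of_mem fun x hx => hS hx]

/-- The edges with both ends in `S`. -/
def cutFinset [G.Loopless] (hfin : G.IsLocallyFinite) (S : Finset α) : Finset E(G) :=
  (finite_cutEdges hfin S).toFinset

@[simp] lemma mem_cutFinset [G.Loopless] {hfin : G.IsLocallyFinite} {S : Finset α} {e : E(G)} :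
    e ∈ cutFinset hfin S ↔ e ∈ cutEdges G S := by
  simp [cutFinset]

/-- The number of edges at `v` with the property `Q`. -/
def incCount (Q : E(G) → Prop) (v : V(G)) : ℕ := {e : E(G) | G.Inc e v ∧ Q e}.ncard

/-- The number of ends of `e` with the property `P`. -/
def endCount (P : V(G) → Prop) (e : E(G)) : ℕ := {v : V(G) | G.Inc e v ∧ P v}.ncard

lemma finite_inc (hfin : G.IsLocallyFinite) (v : V(G)) : {e : E(G) | G.Inc e v}.Finite :=
  Set.Finite.subset (Set.Finite.preimage (f := ((↑) : E(G) → β)) Subtype.val_injective.injOn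
    (hfin v v.2)) fun _ h => h

lemma setOf_inc_eq (e : E(G)) : {v : V(G) | G.Inc e v} = {tailV e, headV e} := by
  have hl := isLink_tail_head e
  ext v
  simp only [Set.mem_ofPred_eq, Set.mem_insert_iff, Set.mem_singleton_iff, tailV, headV,
    Subtype.ext_iff]
  refine ⟨fun h => h.eq_or_eq_of_isLink hl, ?_⟩
  rintro (h | h) <;> rw [h]
  exacts [hl.inc_left, hl.inc_right]

lemma finite_ends (e : E(G)) : {v : V(G) | G.Inc e v}.Finite := by
  rw [setOf_inc_eq]
  exact Set.toFinite _

lemma endCount_true [G.Loopless] (e : E(G)) : endCount (fun _ => True) e = 2 := by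
  simp only [endCount, and_true, setOf_inc_eq]
  refine Set.ncard_pair fun h => (isLink_tail_head e).ne (congrArg Subtype.val h)

lemma incCount_true (v : V(G)) : incCount (fun _ => True) v = G.valence v := by
  rw [incCount, valence, ← Set.ncard_image_of_injective _ Subtype.val_injective]
  congr 1
  ext e
  simp only [and_true, Set.mem_image, Set.mem_ofPred_eq, mem_incidenceSet]
  exact ⟨by rintro ⟨e, h, rfl⟩; exact h, fun h => ⟨⟨e, h.edge_mem⟩, h, rfl⟩⟩

lemma incCount_pos (hfin : G.IsLocallyFinite) {Q : E(G) → Prop} {v : V(G)} {e : E(G)}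
    (hi : G.Inc e v) (he : Q e) : 0 < incCount Q v :=
  (Set.ncard_pos ((finite_inc hfin v).subset fun _ h => h.1)).2 ⟨e, hi, he⟩

lemma endCount_pos {P : V(G) → Prop} {v : V(G)} {e : E(G)}
    (hi : G.Inc e v) (hv : P v) : 0 < endCount P e :=
  (Set.ncard_pos ((finite_ends e).subset fun _ h => h.1)).2 ⟨v, hi, hv⟩

-- Double counting of incidences. An edge of the cut network has all its ends in `S`, while a
-- boundary edge has only one; `r` collects the contribution of the boundary edges.
open Classical in
lemma sum_incCount_eq [G.Loopless] (hfin : G.IsLocallyFinite) (S : Finset α)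
    (P : V(G) → Prop) (Q : E(G) → Prop) :
    ∃ r ≤ (G.edgeBoundary S).ncard,
      ∑ v ∈ (vertexFinset G S).filter P, incCount Q v =
        ∑ e ∈ (cutFinset hfin S).filter Q, endCount P e + r := by
  set F := (finite_shortEdges hfin S).toFinset with hF
  have hsub : cutFinset hfin S ⊆ F := by
    intro e he
    rw [hF, Set.Finite.mem_toFinset]
    exact cutEdges_subset_shortEdges S (by simpa using he)
  have h1 : ∑ v ∈ (vertexFinset G S).filter P, incCount Q v =
      ∑ v ∈ (vertexFinset G S).filter P,
        ((F.filter Q).bipartiteAbove (fun (v : V(G)) (e : E(G)) => G.Inc e v) v).card := by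
    refine Finset.sum_congr rfl fun v hv => ?_
    rw [incCount, ← Set.ncard_coe_finset]
    congr 1
    ext e
    simp only [Set.mem_ofPred_eq, Finset.bipartiteAbove, Finset.coe_filter, Finset.mem_filter, hF,
      Set.Finite.mem_toFinset]
    refine ⟨fun h => ⟨⟨?_, h.2⟩, h.1⟩, fun h => ⟨h.2, h.1.2⟩⟩
    obtain ⟨y, hy⟩ := h.1
    rw [mem_shortEdges_iff hy]
    simp only [Finset.mem_filter, mem_vertexFinset] at hv
    exact Or.inl hv.1
  rw [h1, Finset.sum_card_bipartiteAbove_eq_sum_card_bipartiteBelow,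
    ← Finset.sum_sdiff (Finset.filter_subset_filter Q hsub), add_comm]
  refine ⟨_, ?_, congrArg₂ _ (Finset.sum_congr rfl fun e he => ?_) rfl⟩
  · rw [ncard_edgeBoundary, Set.ncard_eq_toFinset_card _ ((finite_shortEdges hfin S).sdiff)]
    refine (Finset.sum_le_card_nsmul _ _ 1 fun e he => ?_).trans ?_
    · simp only [Finset.mem_sdiff, Finset.mem_filter, mem_cutFinset, not_and] at he
      rw [Finset.card_le_one]
      have hl := isLink_tail_head e
      have he2 : ¬ (tail e ∈ S ∧ head e ∈ S) := fun h =>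
        he.2 ((mem_cutEdges_iff hl).2 h) he.1.2
      simp only [Finset.bipartiteBelow, Finset.mem_filter, mem_vertexFinset]
      rintro v ⟨⟨hv, -⟩, hiv⟩ w ⟨⟨hw, -⟩, hiw⟩
      ext
      rcases hiv.eq_or_eq_of_isLink hl with h | h <;>
        rcases hiw.eq_or_eq_of_isLink hl with h' | h' <;> rw [h] at hv ⊢ <;> rw [h'] at hw ⊢
      exacts [absurd ⟨hv, hw⟩ he2, absurd ⟨hw, hv⟩ he2]
    · rw [smul_eq_mul, mul_one]
      refine Finset.card_le_card fun e he => ?_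
      simp only [Finset.mem_sdiff, Finset.mem_filter, mem_cutFinset, not_and, hF,
        Set.Finite.mem_toFinset, Set.mem_sdiff] at he ⊢
      exact ⟨he.1.1, fun h => he.2 h he.1.2⟩
  · rw [endCount, ← Set.ncard_coe_finset]
    congr 1
    ext v
    simp only [Set.mem_ofPred_eq, Finset.bipartiteBelow, Finset.coe_filter, Finset.mem_filter,
      mem_vertexFinset]
    refine ⟨fun h => ⟨h.2, h.1.2⟩, fun h => ⟨⟨?_, h.2⟩, h.1⟩⟩
    obtain ⟨y, hy⟩ := h.1
    simp only [Finset.mem_filter, mem_cutFinset] at he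
    exact ((mem_cutEdges_iff hy).1 he.1).1

end Incidence

/-! ### Kinds -/

section Kinds

variable {α β : Type*} {G : Graph α β}

lemma vertexKind_eq_iff {v w : V(G)} :
    G.vertexKind v = G.vertexKind w ↔ ∃ s : G.Symmetry, s.onV v = w :=
  Quotient.eq (r := G.vertexSetoid)

lemma edgeKind_eq_iff {e f : E(G)} :
    G.edgeKind e = G.edgeKind f ↔ ∃ s : G.Symmetry, s.onE e = f :=
  Quotient.eq (r := G.edgeSetoid)

lemma surjective_vertexKind : Function.Surjective G.vertexKind := Quotient.mk_surjective

lemma surjective_edgeKind : Function.Surjective G.edgeKind := Quotient.mk_surjective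

namespace Symmetry

lemma vertexKind_onV (s : G.Symmetry) (v : V(G)) : G.vertexKind (s.onV v) = G.vertexKind v :=
  (vertexKind_eq_iff.2 ⟨s, rfl⟩).symm

lemma edgeKind_onE (s : G.Symmetry) (e : E(G)) : G.edgeKind (s.onE e) = G.edgeKind e :=
  (edgeKind_eq_iff.2 ⟨s, rfl⟩).symm

lemma inc_iff (s : G.Symmetry) (e : E(G)) (v : V(G)) :
    G.Inc (s.onE e) (s.onV v : α) ↔ G.Inc e v := by
  constructor
  · rintro ⟨y, hy⟩
    have := s.isLink_iff e v (s.onV.symm ⟨y, hy.right_mem⟩)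
    rw [Equiv.apply_symm_apply] at this
    exact (this.1 hy).inc_left
  · rintro ⟨y, hy⟩
    exact ((s.isLink_iff e v ⟨y, hy.right_mem⟩).2 hy).inc_left

lemma incCount_onV (s : G.Symmetry) {Q : E(G) → Prop} (hQ : ∀ e, Q (s.onE e) ↔ Q e) (v : V(G)) :
    incCount Q (s.onV v) = incCount Q v := by
  rw [incCount, incCount, ← Set.ncard_image_of_injective {e : E(G) | G.Inc e v ∧ Q e} s.onE.injective]
  congr 1
  ext f
  obtain ⟨e, rfl⟩ := s.onE.surjective f
  rw [s.onE.injective.mem_set_image]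
  simp only [Set.mem_ofPred_eq, s.inc_iff, hQ]

lemma endCount_onE (s : G.Symmetry) {P : V(G) → Prop} (hP : ∀ v, P (s.onV v) ↔ P v) (e : E(G)) :
    endCount P (s.onE e) = endCount P e := by
  rw [endCount, endCount, ← Set.ncard_image_of_injective {v : V(G) | G.Inc e v ∧ P v} s.onV.injective]
  congr 1
  ext w
  obtain ⟨v, rfl⟩ := s.onV.surjective w
  rw [s.onV.injective.mem_set_image]
  simp only [Set.mem_ofPred_eq, s.inc_iff, hP]

end Symmetry

lemma incCount_congr {v w : V(G)} (h : G.vertexKind v = G.vertexKind w) (j : G.EdgeKind) :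
    incCount (fun e => G.edgeKind e = j) v = incCount (fun e => G.edgeKind e = j) w := by
  obtain ⟨s, rfl⟩ := vertexKind_eq_iff.1 h
  rw [s.incCount_onV fun e => by rw [s.edgeKind_onE]]

lemma endCount_congr {e f : E(G)} (h : G.edgeKind e = G.edgeKind f) (k : G.VertexKind) :
    endCount (fun v => G.vertexKind v = k) e = endCount (fun v => G.vertexKind v = k) f := by
  obtain ⟨s, rfl⟩ := edgeKind_eq_iff.1 h
  rw [s.endCount_onE fun v => by rw [s.vertexKind_onV]]

lemma valence_congr {v w : V(G)} (h : G.vertexKind v = G.vertexKind w) :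
    G.valence v = G.valence w := by
  obtain ⟨s, rfl⟩ := vertexKind_eq_iff.1 h
  rw [← incCount_true, ← incCount_true, s.incCount_onV fun e => Iff.rfl]

lemma exists_inc (hinf : V(G).Infinite) (hconn : G.IsConnected) (v : V(G)) :
    ∃ e : E(G), G.Inc e v := by
  obtain ⟨y, hy, hne⟩ := hinf.exists_notMem_finset {(v : α)}
  rcases (hconn.2 v v.2 y hy).cases_head with h | ⟨z, ⟨e, he⟩, -⟩
  · simp [h] at hne
  · exact ⟨⟨e, he.edge_mem⟩, he.inc_left⟩

/-- Every edge can be moved to one at a chosen representative of the kind of its tail, and only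
finitely many edges meet these representatives. -/
lemma finite_edgeKind (hfin : G.IsLocallyFinite) [Finite G.VertexKind] : Finite G.EdgeKind := by
  have h : (⋃ k : G.VertexKind, G.edgeKind '' {e | G.Inc e (surjective_vertexKind k).choose}).Finite :=
    Set.finite_iUnion fun k => (finite_inc hfin _).image _
  refine Set.finite_univ_iff.1 (h.subset fun j _ => ?_)
  obtain ⟨e, rfl⟩ := surjective_edgeKind j
  rw [Set.mem_iUnion]
  refine ⟨G.vertexKind (tailV e), ?_⟩
  obtain ⟨s, hs⟩ := vertexKind_eq_iff.1
    (surjective_vertexKind (G.vertexKind (tailV e))).choose_spec.symm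
  rw [← hs]
  exact ⟨s.onE e, (s.inc_iff e _).2 (isLink_tail_head e).inc_left, s.edgeKind_onE e⟩

lemma finite_vertexKind (hinf : V(G).Infinite) (hconn : G.IsConnected) [Finite G.EdgeKind] :
    Finite G.VertexKind := by
  have h : (⋃ j : G.EdgeKind, G.vertexKind ''
      {v | G.Inc (surjective_edgeKind j).choose v}).Finite :=
    Set.finite_iUnion fun j => (finite_ends _).image _
  refine Set.finite_univ_iff.1 (h.subset fun k _ => ?_)
  obtain ⟨v, rfl⟩ := surjective_vertexKind k
  obtain ⟨e, he⟩ := exists_inc hinf hconn v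
  rw [Set.mem_iUnion]
  refine ⟨G.edgeKind e, ?_⟩
  obtain ⟨s, hs⟩ := edgeKind_eq_iff.1 (surjective_edgeKind (G.edgeKind e)).choose_spec.symm
  rw [← hs]
  exact ⟨s.onV v, (s.inc_iff e _).2 he, s.vertexKind_onV v⟩

lemma IsSymmetrical.finite_kinds (hsymm : G.IsSymmetrical) (hinf : V(G).Infinite)
    (hconn : G.IsConnected) (hfin : G.IsLocallyFinite) :
    Finite G.VertexKind ∧ Finite G.EdgeKind := by
  rcases hsymm with h | h
  · exact ⟨h, finite_edgeKind hfin⟩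
  · exact ⟨finite_vertexKind hinf hconn, h⟩

end Kinds

/-! ### Densities along pinching sequences -/

section Density

variable {α β : Type*} {G : Graph α β}

/-- The quotient of `φ` by the size tends to `c` along every pinching sequence. -/
def HasDensity (G : Graph α β) (φ : Finset α → ℝ) (c : ℝ) : Prop :=
  ∀ T, G.IsPinching T → Tendsto (fun n => φ (T n) / ((T n).card : ℝ)) atTop (𝓝 c)

namespace HasDensity

variable {φ ψ : Finset α → ℝ} {c d : ℝ}

lemma congr (h : G.HasDensity φ c) (hψ : ∀ S : Finset α, (S : Set α) ⊆ V(G) → φ S = ψ S) :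
    G.HasDensity ψ c := fun T hT => (h T hT).congr fun n => by rw [hψ _ (hT.1.1 n)]

lemma add (h : G.HasDensity φ c) (k : G.HasDensity ψ d) :
    G.HasDensity (fun S => φ S + ψ S) (c + d) := fun T hT =>
  ((h T hT).add (k T hT)).congr fun _ => (add_div _ _ _).symm

lemma sub (h : G.HasDensity φ c) (k : G.HasDensity ψ d) :
    G.HasDensity (fun S => φ S - ψ S) (c - d) := fun T hT =>
  ((h T hT).sub (k T hT)).congr fun _ => (sub_div _ _ _).symm

lemma const_mul (a : ℝ) (h : G.HasDensity φ c) :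
    G.HasDensity (fun S => a * φ S) (a * c) := fun T hT =>
  ((h T hT).const_mul a).congr fun _ => (mul_div_assoc _ _ _).symm

lemma sum {ι : Type*} {s : Finset ι} {φ : ι → Finset α → ℝ} {c : ι → ℝ}
    (h : ∀ i ∈ s, G.HasDensity (φ i) (c i)) :
    G.HasDensity (fun S => ∑ i ∈ s, φ i S) (∑ i ∈ s, c i) := fun T hT =>
  (tendsto_finsetSum s fun i hi => h i hi T hT).congr fun _ => (Finset.sum_div _ _ _).symm

/-- Errors up to the size of the edge boundary disappear in the limit; this is how pinching enters.
-/
lemma squeeze (h : G.HasDensity φ c) (hψ : ∀ S : Finset α, (S : Set α) ⊆ V(G) →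
    φ S ≤ ψ S ∧ ψ S ≤ φ S + (G.edgeBoundary S).ncard) : G.HasDensity ψ c := fun T hT => by
  have h1 := (h T hT).add hT.2
  rw [add_zero] at h1
  refine tendsto_of_tendsto_of_tendsto_of_le_of_le (h T hT) h1 (fun n => ?_) fun n => ?_
  · exact div_le_div_of_nonneg_right (hψ _ (hT.1.1 n)).1 (Nat.cast_nonneg _)
  · beta_reduce
    rw [← add_div]
    exact div_le_div_of_nonneg_right (hψ _ (hT.1.1 n)).2 (Nat.cast_nonneg _)

/-- Without a pinching sequence `HasDensity` would be vacuous. -/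
lemma unique (h : G.HasDensity φ c) (k : G.HasDensity φ d) (hsmall : G.IsSmallish) : c = d := by
  obtain ⟨T, hT⟩ := hsmall
  exact tendsto_nhds_unique (h T hT) (k T hT)

end HasDensity

lemma hasDensity_zero : G.HasDensity (fun _ => 0) 0 := fun T _ => by simp

lemma IsSwelling.eventually_card_ne_zero {T : ℕ → Finset α} (hT : G.IsSwelling T)
    (hne : V(G).Nonempty) : ∀ᶠ n in atTop, ((T n).card : ℝ) ≠ 0 := by
  obtain ⟨x, hx⟩ := hne
  filter_upwards [hT.2 {x} (by simpa using hx)] with n hn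
  rw [Nat.cast_ne_zero, Finset.card_ne_zero]
  exact ⟨x, hn (by simp)⟩

lemma hasDensity_card (hne : V(G).Nonempty) : G.HasDensity (fun S => (S.card : ℝ)) 1 := fun _ hT =>
  tendsto_const_nhds.congr' ((hT.1.eventually_card_ne_zero hne).mono fun _ hn =>
    (div_self hn).symm)

lemma IsSwelling.tendsto_card {T : ℕ → Finset α} (hT : G.IsSwelling T) (hinf : V(G).Infinite) :
    Tendsto (fun n => ((T n).card : ℝ)) atTop atTop := by
  refine tendsto_natCast_atTop_atTop.comp (tendsto_atTop.2 fun m => ?_)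
  obtain ⟨S, hS, rfl⟩ := hinf.exists_subset_card_eq m
  exact (hT.2 S hS).mono fun n hn => Finset.card_le_card hn

lemma hasDensity_one (hinf : V(G).Infinite) : G.HasDensity (fun _ => 1) 0 := fun _ hT =>
  (tendsto_const_nhds (x := (1 : ℝ))).div_atTop (hT.1.tendsto_card hinf)

lemma HasDensity.tendsto_div {φ ψ : Finset α → ℝ} {c d : ℝ} (h : G.HasDensity φ c)
    (k : G.HasDensity ψ d) (hd : d ≠ 0) (hne : V(G).Nonempty) {T : ℕ → Finset α}
    (hT : G.IsPinching T) : Tendsto (fun n => φ (T n) / ψ (T n)) atTop (𝓝 (c / d)) :=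
  ((h T hT).div (k T hT) hd).congr' ((hT.1.eventually_card_ne_zero hne).mono fun _ hn =>
    div_div_div_cancel_right₀ hn _ _)

end Density

/-! ### Densities of the kinds -/

section KindDensity

variable {α β : Type*} {G : Graph α β}

open Classical in
/-- The number of vertices of a given kind in `S`. -/
def vertexCount (k : G.VertexKind) (S : Finset α) : ℝ :=
  ((vertexFinset G S).filter fun v => G.vertexKind v = k).card

open Classical in
/-- The number of edges of a given kind with both ends in `S`. -/
def edgeCount [G.Loopless] (hfin : G.IsLocallyFinite) (j : G.EdgeKind) (S : Finset α) : ℝ :=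
  ((cutFinset hfin S).filter fun e => G.edgeKind e = j).card

lemma sum_vertexFinset_eq [Fintype G.VertexKind] (ψ : G.VertexKind → ℝ) (S : Finset α) :
    ∑ v ∈ vertexFinset G S, ψ (G.vertexKind v) = ∑ k, ψ k * vertexCount k S := by
  classical
  rw [← Finset.sum_fiberwise (vertexFinset G S) G.vertexKind]
  refine Finset.sum_congr rfl fun k _ => ?_
  rw [Finset.sum_congr rfl fun v hv => by rw [(Finset.mem_filter.1 hv).2], Finset.sum_const,
    nsmul_eq_mul, mul_comm, vertexCount]

lemma sum_cutFinset_eq [G.Loopless] (hfin : G.IsLocallyFinite) [Fintype G.EdgeKind]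
    (ψ : G.EdgeKind → ℝ) (S : Finset α) :
    ∑ e ∈ cutFinset hfin S, ψ (G.edgeKind e) = ∑ j, ψ j * edgeCount hfin j S := by
  classical
  rw [← Finset.sum_fiberwise (cutFinset hfin S) G.edgeKind]
  refine Finset.sum_congr rfl fun k _ => ?_
  rw [Finset.sum_congr rfl fun v hv => by rw [(Finset.mem_filter.1 hv).2], Finset.sum_const,
    nsmul_eq_mul, mul_comm, edgeCount]

lemma hasDensity_incidence [G.Loopless] (hfin : G.IsLocallyFinite) (v : V(G)) (e : E(G)) :
    G.HasDensity (fun S => vertexCount (G.vertexKind v) S *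
        incCount (fun f => G.edgeKind f = G.edgeKind e) v -
      edgeCount hfin (G.edgeKind e) S *
        endCount (fun w => G.vertexKind w = G.vertexKind v) e) 0 := by
  classical
  refine hasDensity_zero.squeeze fun S _ => ?_
  obtain ⟨r, hr, h⟩ := sum_incCount_eq hfin S (fun w => G.vertexKind w = G.vertexKind v)
    (fun f => G.edgeKind f = G.edgeKind e)
  rw [Finset.sum_congr rfl fun w hw => incCount_congr (Finset.mem_filter.1 hw).2 _,
    Finset.sum_const, Finset.sum_congr rfl fun f hf => endCount_congr (Finset.mem_filter.1 hf).2 _,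
    Finset.sum_const, smul_eq_mul, smul_eq_mul] at h
  have h' : vertexCount (G.vertexKind v) S *
        (incCount (fun f => G.edgeKind f = G.edgeKind e) v : ℝ) =
      edgeCount hfin (G.edgeKind e) S *
        (endCount (fun w => G.vertexKind w = G.vertexKind v) e : ℝ) + r := by
    rw [vertexCount, edgeCount]
    exact_mod_cast h
  have hr' : (r : ℝ) ≤ (G.edgeBoundary S).ncard := Nat.cast_le.2 hr
  rw [h']
  constructor
  · simp
  · linarith

/-- `X` is a reference count not yet known to have a density, so proportionality is expressed by a
difference of density 0. Incidence of `e` and `v` makes `a` and `b` below nonzero, and a·#v ≈ b·#e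
gives the new ratio. -/
lemma hasDensity_edgeCount_of_inc [G.Loopless] (hfin : G.IsLocallyFinite) {v : V(G)} {e : E(G)}
    (hi : G.Inc e v) {X : Finset α → ℝ} {c : ℚ} (hc : 0 < c)
    (h : G.HasDensity (fun S => vertexCount (G.vertexKind v) S - c * X S) 0) :
    ∃ d : ℚ, 0 < d ∧ G.HasDensity (fun S => edgeCount hfin (G.edgeKind e) S - d * X S) 0 := by
  have h1 := hasDensity_incidence hfin v e
  have ha := incCount_pos hfin (Q := fun f => G.edgeKind f = G.edgeKind e) hi rfl
  have hb := endCount_pos (P := fun w => G.vertexKind w = G.vertexKind v) hi rfl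
  generalize incCount (fun f => G.edgeKind f = G.edgeKind e) v = a at h1 ha
  generalize endCount (fun w => G.vertexKind w = G.vertexKind v) e = b at h1 hb
  have hb' : (b : ℝ) ≠ 0 := by positivity
  refine ⟨c * a / b, by positivity, ?_⟩
  have h2 := (h.const_mul (a / b : ℝ)).sub (h1.const_mul (1 / b : ℝ))
  rw [mul_zero, mul_zero, sub_zero] at h2
  refine h2.congr fun S _ => ?_
  push_cast
  field_simp
  ring

lemma hasDensity_vertexCount_of_inc [G.Loopless] (hfin : G.IsLocallyFinite) {v : V(G)} {e : E(G)}
    (hi : G.Inc e v) {X : Finset α → ℝ} {d : ℚ} (hd : 0 < d)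
    (h : G.HasDensity (fun S => edgeCount hfin (G.edgeKind e) S - d * X S) 0) :
    ∃ c : ℚ, 0 < c ∧ G.HasDensity (fun S => vertexCount (G.vertexKind v) S - c * X S) 0 := by
  have h1 := hasDensity_incidence hfin v e
  have ha := incCount_pos hfin (Q := fun f => G.edgeKind f = G.edgeKind e) hi rfl
  have hb := endCount_pos (P := fun w => G.vertexKind w = G.vertexKind v) hi rfl
  generalize incCount (fun f => G.edgeKind f = G.edgeKind e) v = a at h1 ha
  generalize endCount (fun w => G.vertexKind w = G.vertexKind v) e = b at h1 hb
  have ha' : (a : ℝ) ≠ 0 := by positivity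
  refine ⟨d * b / a, by positivity, ?_⟩
  have h2 := (h.const_mul (b / a : ℝ)).add (h1.const_mul (1 / a : ℝ))
  rw [mul_zero, mul_zero, add_zero] at h2
  refine h2.congr fun S _ => ?_
  push_cast
  field_simp
  ring

lemma exists_vertexCount_ratio [G.Loopless] (hconn : G.IsConnected) (hfin : G.IsLocallyFinite)
    (v₀ v : V(G)) : ∃ c : ℚ, 0 < c ∧ G.HasDensity
      (fun S => vertexCount (G.vertexKind v) S - c * vertexCount (G.vertexKind v₀) S) 0 := by
  suffices H : ∀ y, Relation.ReflTransGen G.Adj v₀ y → ∀ hy : y ∈ V(G), ∃ c : ℚ, 0 < c ∧ G.HasDensity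
      (fun S => vertexCount (G.vertexKind ⟨y, hy⟩) S -
        c * vertexCount (G.vertexKind v₀) S) 0 from
    H v (hconn.2 v₀ v₀.2 v v.2) v.2
  intro y hy
  induction hy with
  | refl =>
    intro _
    refine ⟨1, one_pos, hasDensity_zero.congr fun S _ => ?_⟩
    simp
  | tail _ hadj ih =>
    intro hy
    obtain ⟨e, hl⟩ := hadj
    obtain ⟨c, hc, h⟩ := ih hl.left_mem
    have he := hl.edge_mem
    lift e to E(G) using he
    obtain ⟨d, hd, h'⟩ := hasDensity_edgeCount_of_inc hfin (v := ⟨_, hl.left_mem⟩) hl.inc_left hc h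
    exact hasDensity_vertexCount_of_inc hfin (v := ⟨_, hy⟩) hl.inc_right hd h'

lemma exists_kind_densities [G.Loopless] (hconn : G.IsConnected) (hfin : G.IsLocallyFinite)
    [Fintype G.VertexKind] :
    ∃ (f : G.VertexKind → ℚ) (h : G.EdgeKind → ℚ), (∀ k, 0 < f k) ∧ (∀ j, 0 < h j) ∧
      ∑ k, f k = 1 ∧ (∀ k, G.HasDensity (vertexCount k) (f k)) ∧
      ∀ j, G.HasDensity (edgeCount hfin j) (h j) := by
  obtain ⟨x₀, hx₀⟩ := hconn.1
  set v₀ : V(G) := ⟨x₀, hx₀⟩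
  set X : Finset α → ℝ := vertexCount (G.vertexKind v₀) with hX
  have hv : ∀ k : G.VertexKind, ∃ c : ℚ, 0 < c ∧
      G.HasDensity (fun S => vertexCount k S - c * X S) 0 := fun k => by
    obtain ⟨v, rfl⟩ := surjective_vertexKind k
    exact exists_vertexCount_ratio hconn hfin v₀ v
  have he : ∀ j : G.EdgeKind, ∃ d : ℚ, 0 < d ∧
      G.HasDensity (fun S => edgeCount hfin j S - d * X S) 0 := fun j => by
    obtain ⟨e, rfl⟩ := surjective_edgeKind j
    obtain ⟨c, hc, h⟩ := hv (G.vertexKind (tailV e))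
    exact hasDensity_edgeCount_of_inc hfin (isLink_tail_head e).inc_left hc h
  choose c hc hvc using hv
  choose d hd hed using he
  have hC : 0 < ∑ k, c k := Finset.sum_pos (fun k _ => hc k) ⟨G.vertexKind v₀, Finset.mem_univ _⟩
  have hC' : ((∑ k, c k : ℚ) : ℝ) ≠ 0 := Rat.cast_ne_zero.2 hC.ne'
  -- The vertex counts of all kinds add up to |S|, so |S| is X times the sum of the ratios, up to
  -- density 0; this fixes the density of the reference count.
  have hXd : G.HasDensity X (1 / (∑ k, c k : ℚ) : ℝ) := by
    have h1 := ((hasDensity_card hconn.1).sub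
      (HasDensity.sum (s := (Finset.univ : Finset G.VertexKind)) fun k _ => hvc k)).const_mul (1 / (∑ k, c k : ℚ) : ℝ)
    rw [Finset.sum_const_zero, sub_zero, mul_one] at h1
    refine h1.congr fun S hS => ?_
    have h2 : (S.card : ℝ) = ∑ k : G.VertexKind, vertexCount k S := by
      have := sum_vertexFinset_eq (G := G) (fun _ => 1) S
      simpa [card_vertexFinset hS] using this
    rw [Finset.sum_sub_distrib, h2, sub_sub_cancel, ← Finset.sum_mul]
    push_cast at hC' ⊢
    field_simp
  refine ⟨fun k => c k / ∑ k, c k, fun j => d j / ∑ k, c k, fun k => div_pos (hc k) hC,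
    fun j => div_pos (hd j) hC, ?_, fun k => ?_, fun j => ?_⟩
  · rw [← Finset.sum_div, div_self hC.ne']
  · have h1 := (hvc k).add (hXd.const_mul (c k))
    rw [zero_add, mul_one_div, ← Rat.cast_div] at h1
    exact h1.congr fun S _ => by ring
  · have h1 := (hed j).add (hXd.const_mul (d j))
    rw [zero_add, mul_one_div, ← Rat.cast_div] at h1
    exact h1.congr fun S _ => by ring

end KindDensity

/-! ### Relative frequencies -/

section Frequency

variable {α β : Type*} {G : Graph α β}

lemma some_mem_shortNetwork_iff {S : Finset α} (hS : (S : Set α) ⊆ V(G)) {v : α} :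
    some v ∈ V(G.shortNetwork S) ↔ v ∈ S := by
  change some v ∈ collapse S '' V(G) ↔ _
  constructor
  · rintro ⟨x, -, hx⟩
    obtain ⟨h, rfl⟩ := some_eq_collapse_iff.1 hx.symm
    exact h
  · exact fun h => ⟨v, hS h, collapse_of_mem h⟩

lemma ncard_vertexSet_shortNetwork (hinf : V(G).Infinite) {S : Finset α}
    (hS : (S : Set α) ⊆ V(G)) : V(G.shortNetwork S).ncard = S.card + 1 := by
  classical
  have h : V(G.shortNetwork S) = (insert none (S.image some) : Finset (Option α)) := by
    ext z
    cases z with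
    | some v => rw [some_mem_shortNetwork_iff hS]; simp
    | none =>
      obtain ⟨y, hy, hyS⟩ := hinf.exists_notMem_finset S
      have h0 : none ∈ V(G.shortNetwork S) := ⟨y, hy, collapse_of_notMem hyS⟩
      simp [h0]
  rw [h, Set.ncard_coe_finset, Finset.card_insert_of_notMem (by simp),
    Finset.card_image_of_injective _ (Option.some_injective α)]

lemma ncard_kind_cutNetwork (k : G.VertexKind) (S : Finset α) :
    ({v : V(G) | (v : α) ∈ V(G.cutNetwork S) ∧ G.vertexKind v = k}.ncard : ℝ) =
      vertexCount k S := by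
  rw [vertexCount, ← Set.ncard_coe_finset]
  congr 2
  ext v
  simp [cutNetwork]

lemma ncard_kind_shortNetwork (k : G.VertexKind) {S : Finset α} (hS : (S : Set α) ⊆ V(G)) :
    ({v : V(G) | some (v : α) ∈ V(G.shortNetwork S) ∧ G.vertexKind v = k}.ncard : ℝ) =
      vertexCount k S := by
  rw [vertexCount, ← Set.ncard_coe_finset]
  congr 2
  ext v
  simp [some_mem_shortNetwork_iff hS]

lemma isVertexFrequency_of_hasDensity (hinf : V(G).Infinite) [Fintype G.VertexKind]
    {f : G.VertexKind → ℚ} (hpos : ∀ k, 0 < f k) (hsum : ∑ k, f k = 1)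
    (hf : ∀ k, G.HasDensity (vertexCount k) (f k)) : G.IsVertexFrequency f where
  pos := hpos
  sum_eq_one := by rw [finsum_eq_sum_of_fintype, hsum]
  tendsto_cut T hT k := by
    refine (hf k T hT).congr fun n => ?_
    rw [ncard_kind_cutNetwork]
    congr 1
    exact congrArg _ (Set.ncard_coe_finset _).symm
  tendsto_short T hT k := by
    -- The short network has |S| + 1 vertices; the extra vertex ∞ has density 0.
    have h1 := (hasDensity_card hinf.nonempty).add (hasDensity_one hinf)
    rw [add_zero] at h1
    have h2 := (hf k).tendsto_div h1 one_ne_zero hinf.nonempty hT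
    rw [div_one] at h2
    refine h2.congr fun n => ?_
    rw [ncard_kind_shortNetwork k (hT.1.1 n), ncard_vertexSet_shortNetwork hinf (hT.1.1 n)]
    push_cast
    rfl

lemma ncard_edgeSet_of_subset {γ : Type*} {H : Graph γ β} (hH : E(H) ⊆ E(G)) :
    E(H).ncard = {e : E(G) | (e : β) ∈ E(H)}.ncard := by
  rw [← Set.ncard_image_of_injective {e : E(G) | (e : β) ∈ E(H)} Subtype.val_injective]
  congr 1
  ext e
  exact ⟨fun h => ⟨⟨e, hH h⟩, h, rfl⟩, by rintro ⟨e, h, rfl⟩; exact h⟩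

lemma ncard_edgeSet_cutNetwork [G.Loopless] (hfin : G.IsLocallyFinite) (S : Finset α) :
    E(G.cutNetwork S).ncard = (cutFinset hfin S).card := by
  have hsub : E(G.cutNetwork S) ⊆ E(G) := fun e ⟨_, _, h⟩ => h.1.edge_mem
  rw [ncard_edgeSet_of_subset hsub, ← Set.ncard_coe_finset]
  congr 1
  ext e
  simp [cutEdges]

lemma ncard_edgeSet_shortNetwork [G.Loopless] (hfin : G.IsLocallyFinite) (S : Finset α) :
    E(G.shortNetwork S).ncard = (cutFinset hfin S).card + (G.edgeBoundary S).ncard := by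
  have hsub : E(G.shortNetwork S) ⊆ E(G) := fun e h => h.1
  rw [ncard_edgeSet_of_subset hsub, ncard_edgeBoundary,
    ← Set.ncard_coe_finset, add_comm,
    show ((cutFinset hfin S : Finset E(G)) : Set E(G)) = cutEdges G S by ext; simp]
  exact (Set.ncard_sdiff_add_ncard_of_subset (cutEdges_subset_shortEdges S)
    (finite_shortEdges hfin S)).symm

lemma hasDensity_card_cutFinset [G.Loopless] (hfin : G.IsLocallyFinite) [Fintype G.EdgeKind]
    {h : G.EdgeKind → ℚ} (hh : ∀ j, G.HasDensity (edgeCount hfin j) (h j)) :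
    G.HasDensity (fun S => ((cutFinset hfin S).card : ℝ)) (∑ j, h j : ℚ) := by
  rw [Rat.cast_sum]
  refine (HasDensity.sum fun j _ => hh j).congr fun S _ => ?_
  have := sum_cutFinset_eq hfin (fun _ => 1) S
  simpa using this.symm

lemma ncard_kind_edges_cutNetwork [G.Loopless] (hfin : G.IsLocallyFinite) (j : G.EdgeKind)
    (S : Finset α) :
    ({e : E(G) | (e : β) ∈ E(G.cutNetwork S) ∧ G.edgeKind e = j}.ncard : ℝ) =
      edgeCount hfin j S := by
  rw [edgeCount, ← Set.ncard_coe_finset]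
  congr 2
  ext v
  simp [cutEdges]

lemma ncard_kind_edges_shortNetwork [G.Loopless] (hfin : G.IsLocallyFinite) (j : G.EdgeKind)
    (S : Finset α) :
    edgeCount hfin j S ≤
        ({e : E(G) | (e : β) ∈ E(G.shortNetwork S) ∧ G.edgeKind e = j}.ncard : ℝ) ∧
      ({e : E(G) | (e : β) ∈ E(G.shortNetwork S) ∧ G.edgeKind e = j}.ncard : ℝ) ≤
        edgeCount hfin j S + (G.edgeBoundary S).ncard := by
  have hF : {e : E(G) | (e : β) ∈ E(G.shortNetwork S) ∧ G.edgeKind e = j}.Finite :=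
    (finite_shortEdges hfin S).subset fun e he => he.1
  have hF' := finite_shortEdges hfin S
  rw [← ncard_kind_edges_cutNetwork, ncard_edgeBoundary]
  constructor
  · refine Nat.cast_le.2 (Set.ncard_le_ncard ?_ hF)
    exact fun e he => ⟨cutEdges_subset_shortEdges S he.1, he.2⟩
  · norm_cast
    refine (Set.ncard_le_ncard ?_ ?_).trans (Set.ncard_union_le _ _)
    · intro e he
      by_cases hc : e ∈ cutEdges G S
      exacts [Or.inl ⟨hc, he.2⟩, Or.inr ⟨he.1, hc⟩]
    · exact hF'.subset (Set.union_subset (fun e he => cutEdges_subset_shortEdges S he.1)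
        Set.sdiff_subset)

lemma isEdgeFrequency_of_hasDensity [G.Loopless] (hfin : G.IsLocallyFinite)
    (hne : V(G).Nonempty) [Fintype G.EdgeKind] {h : G.EdgeKind → ℚ} (hpos : ∀ j, 0 < h j)
    (hY : 0 < ∑ j, h j) (hh : ∀ j, G.HasDensity (edgeCount hfin j) (h j)) :
    G.IsEdgeFrequency fun j => h j / ∑ j, h j where
  pos j := div_pos (hpos j) hY
  sum_eq_one := by rw [finsum_eq_sum_of_fintype, ← Finset.sum_div, div_self hY.ne']
  tendsto_cut T hT j := by
    rw [Rat.cast_div]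
    refine ((hh j).tendsto_div (hasDensity_card_cutFinset hfin hh)
      (Rat.cast_ne_zero.2 hY.ne') hne hT).congr fun n => ?_
    rw [ncard_kind_edges_cutNetwork hfin, ncard_edgeSet_cutNetwork hfin]
  tendsto_short T hT j := by
    rw [Rat.cast_div]
    have h1 := (hh j).squeeze fun S _ => ncard_kind_edges_shortNetwork hfin j S
    have h2 : G.HasDensity (fun S => (E(G.shortNetwork S).ncard : ℝ)) (∑ j, h j : ℚ) :=
      (hasDensity_card_cutFinset hfin hh).squeeze fun S _ => by
        rw [ncard_edgeSet_shortNetwork hfin]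
        push_cast
        exact ⟨by simp, le_rfl⟩
    exact h1.tendsto_div h2 (Rat.cast_ne_zero.2 hY.ne') hne hT

/-- A function constant on the fibres of a surjection factors through it. -/
lemma exists_factor {X Y Z : Type*} {f : X → Y} (hf : Function.Surjective f) {φ : X → Z}
    (hφ : ∀ x x', f x = f x' → φ x = φ x') : ∃ ψ : Y → Z, ∀ x, φ x = ψ (f x) :=
  ⟨fun y => φ (hf y).choose, fun x => hφ _ _ (hf (f x)).choose_spec.symm⟩

end Frequency

/-! ### The averages -/

section Average

variable {α β : Type*} {G : Graph α β}

lemma hasDensity_sum_valence [G.Loopless] (hfin : G.IsLocallyFinite) [Fintype G.EdgeKind]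
    {h : G.EdgeKind → ℚ} (hh : ∀ j, G.HasDensity (edgeCount hfin j) (h j)) :
    G.HasDensity (fun S => ∑ v ∈ vertexFinset G S, (G.valence v : ℝ)) (2 * (∑ j, h j : ℚ)) := by
  refine ((hasDensity_card_cutFinset hfin hh).const_mul 2).squeeze fun S _ => ?_
  obtain ⟨r, hr, heq⟩ := sum_incCount_eq hfin S (fun _ => True) (fun _ => True)
  simp only [incCount_true, endCount_true, Finset.filter_true, Finset.sum_const, smul_eq_mul] at heq
  have h1 : ∑ v ∈ vertexFinset G S, (G.valence v : ℝ) = 2 * (cutFinset hfin S).card + r := by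
    rw [mul_comm]
    exact_mod_cast heq
  have h2 : (r : ℝ) ≤ (G.edgeBoundary S).ncard := Nat.cast_le.2 hr
  rw [h1]
  constructor
  · simp
  · linarith

lemma sum_oddVec_le_sum_evenVec [G.Loopless] (hfin : G.IsLocallyFinite) (S : Finset α) :
    ∑ e ∈ cutFinset hfin S, ‖oddVec hfin e‖ ^ 2 ≤ ∑ e ∈ cutFinset hfin S, ‖evenVec hfin e‖ ^ 2 :=
  Finset.sum_le_sum fun e _ => pow_le_pow_left₀ (norm_nonneg _) (norm_oddVec_le_norm_evenVec hfin e) 2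

lemma hasDensity_neg_boundary :
    G.HasDensity (fun S => -((G.edgeBoundary S).ncard : ℝ)) 0 := fun T hT => by
  have := hT.2.neg
  rw [neg_zero] at this
  exact this.congr fun n => (neg_div _ _).symm

lemma hasDensity_sum_evenVec [G.Loopless] (hinf : V(G).Infinite) (hconn : G.IsConnected)
    (hfin : G.IsLocallyFinite) :
    G.HasDensity (fun S => ∑ e ∈ cutFinset hfin S, ‖evenVec hfin e‖ ^ 2) 1 := by
  -- The squeeze starts from the lower bound |S| - |∂S|, so its upper bound is exactly |S|.
  have h := (hasDensity_card hinf.nonempty).add (hasDensity_neg_boundary (G := G))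
  rw [add_zero] at h
  refine h.squeeze fun S hS => ?_
  have h1 := card_le_sum_oddVec_add hfin hinf hconn hS
  have h2 := sum_oddVec_le_sum_evenVec hfin S
  have h3 := sum_evenVec_le hfin hS
  rw [cutFinset] at *
  constructor <;> linarith

lemma hasDensity_sum_oddVec [G.Loopless] (hinf : V(G).Infinite) (hconn : G.IsConnected)
    (hfin : G.IsLocallyFinite) :
    G.HasDensity (fun S => ∑ e ∈ cutFinset hfin S, ‖oddVec hfin e‖ ^ 2) 1 := by
  have h := (hasDensity_card hinf.nonempty).add (hasDensity_neg_boundary (G := G))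
  rw [add_zero] at h
  refine h.squeeze fun S hS => ?_
  have h1 := card_le_sum_oddVec_add hfin hinf hconn hS
  have h2 := sum_oddVec_le_sum_evenVec hfin S
  have h3 := sum_evenVec_le hfin hS
  rw [cutFinset] at *
  constructor <;> linarith

/-- Densities are per vertex and frequencies per edge, hence the division by the number of edges per
vertex. -/
lemma isEdgeAverage_of_hasDensity [G.Loopless] (hfin : G.IsLocallyFinite) (hne : V(G).Nonempty)
    (hsmall : G.IsSmallish) [Fintype G.EdgeKind] {h : G.EdgeKind → ℚ} (hpos : ∀ j, 0 < h j)
    (hY : 0 < ∑ j, h j) (hh : ∀ j, G.HasDensity (edgeCount hfin j) (h j)) {φ : E(G) → ℝ}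
    (hφ : ∀ (s : G.Symmetry) (e : E(G)), φ (s.onE e) = φ e) {c : ℝ}
    (hc : G.HasDensity (fun S => ∑ e ∈ cutFinset hfin S, φ e) c) :
    G.IsEdgeAverage φ (c / (∑ j, h j : ℚ)) := by
  obtain ⟨ψ, hψ⟩ := exists_factor (surjective_edgeKind (G := G)) (φ := φ) fun e f hef => by
    obtain ⟨s, rfl⟩ := edgeKind_eq_iff.1 hef
    exact (hφ s e).symm
  refine ⟨_, ψ, isEdgeFrequency_of_hasDensity hfin hne hpos hY hh, hψ, ?_⟩
  have h1 : G.HasDensity (fun S => ∑ e ∈ cutFinset hfin S, φ e) (∑ j, ψ j * h j) :=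
    (HasDensity.sum (s := (Finset.univ : Finset G.EdgeKind)) fun j _ =>
      (hh j).const_mul (ψ j)).congr fun S _ => by
        simp_rw [hψ]
        exact (sum_cutFinset_eq hfin ψ S).symm
  rw [hc.unique h1 hsmall, finsum_eq_sum_of_fintype, Finset.sum_div]
  refine Finset.sum_congr rfl fun j _ => ?_
  push_cast
  ring

lemma isVertexAverage_of_hasDensity (hinf : V(G).Infinite)
    (hsmall : G.IsSmallish) [Fintype G.VertexKind] {f : G.VertexKind → ℚ} (hpos : ∀ k, 0 < f k)
    (hsum : ∑ k, f k = 1) (hf : ∀ k, G.HasDensity (vertexCount k) (f k)) {φ : V(G) → ℝ}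
    (hφ : ∀ v w, G.vertexKind v = G.vertexKind w → φ v = φ w) {c : ℝ}
    (hc : G.HasDensity (fun S => ∑ v ∈ vertexFinset G S, φ v) c) :
    G.IsVertexAverage φ c := by
  obtain ⟨ψ, hψ⟩ := exists_factor (surjective_vertexKind (G := G)) hφ
  refine ⟨f, ψ, isVertexFrequency_of_hasDensity hinf hpos hsum hf, hψ, ?_⟩
  have h1 : G.HasDensity (fun S => ∑ v ∈ vertexFinset G S, φ v) (∑ k, ψ k * f k) :=
    (HasDensity.sum (s := (Finset.univ : Finset G.VertexKind)) fun k _ =>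
      (hf k).const_mul (ψ k)).congr fun S _ => by
        simp_rw [hψ]
        exact (sum_vertexFinset_eq ψ S).symm
  rw [hc.unique h1 hsmall, finsum_eq_sum_of_fintype]
  exact Finset.sum_congr rfl fun j _ => mul_comm _ _

end Average

end Graph

end

theorem mainTheorem1 {α β : Type*} (G : Graph α β) [G.Loopless]
    (hinf : V(G).Infinite) (hconn : G.IsConnected) (hfin : G.IsLocallyFinite)
    (hsmall : G.IsSmallish) (hsymm : G.IsSymmetrical) :
    ∃ (evenRes oddRes : E(G) → ℝ) (avgEven avgOdd avgValence : ℝ),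
      (∀ (e : E(G)) (p q : α), G.IsLink e p q → G.IsEvenResistance p q (evenRes e)) ∧
      (∀ (e : E(G)) (p q : α), G.IsLink e p q → G.IsOddResistance p q (oddRes e)) ∧
      G.IsEdgeAverage evenRes avgEven ∧
      G.IsEdgeAverage oddRes avgOdd ∧
      G.IsVertexAverage (fun v => (G.valence v : ℝ)) avgValence ∧
      avgEven = avgOdd ∧ avgOdd = 2 / avgValence := by
  obtain ⟨_, _⟩ := hsymm.finite_kinds hinf hconn hfin
  have := Fintype.ofFinite G.VertexKind
  have := Fintype.ofFinite G.EdgeKind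
  obtain ⟨f, h, hf, hh, hsum, hfd, hhd⟩ := Graph.exists_kind_densities hconn hfin
  have hY : 0 < ∑ j, h j := by
    obtain ⟨x, hx⟩ := hinf.nonempty
    obtain ⟨e, -⟩ := Graph.exists_inc hinf hconn ⟨x, hx⟩
    exact Finset.sum_pos (fun j _ => hh j) ⟨G.edgeKind e, Finset.mem_univ _⟩
  refine ⟨fun e => ‖Graph.evenVec hfin e‖ ^ 2, fun e => ‖Graph.oddVec hfin e‖ ^ 2,
    1 / (∑ j, h j : ℚ), 1 / (∑ j, h j : ℚ), 2 * (∑ j, h j : ℚ),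
    fun e p q hl => Graph.isEvenResistance_edge hfin hl,
    fun e p q hl => Graph.isOddResistance_edge hfin hl,
    Graph.isEdgeAverage_of_hasDensity hfin hinf.nonempty hsmall hh hY hhd
      (fun s e => by rw [s.norm_evenVec_onE]) (Graph.hasDensity_sum_evenVec hinf hconn hfin),
    Graph.isEdgeAverage_of_hasDensity hfin hinf.nonempty hsmall hh hY hhd
      (fun s e => s.norm_sq_oddVec_onE hfin e) (Graph.hasDensity_sum_oddVec hinf hconn hfin),
    Graph.isVertexAverage_of_hasDensity hinf hsmall hf hsum hfd
      (fun v w hvw => by rw [Graph.valence_congr hvw]) (Graph.hasDensity_sum_valence hfin hhd),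
    rfl, ?_⟩
  have hY' : ((∑ j, h j : ℚ) : ℝ) ≠ 0 := Rat.cast_ne_zero.2 hY.ne'
  field_simp
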